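/- Let $m\ge 2$ and let $W=\mathbb Z_2\times D_{2m}$ be the reflection group on $\mathbb R^3$ with root system $R=\{\pm\alpha_0,\alpha_1,\dots,\alpha_{2m}\}$, where $\alpha_0=(0,0,1)$, $\alpha_j=(\sin(j\pi/m),-\cos(j\pi/m),0)$ for $1\le j\le 2m$, and with positive roots $R_+=\{\alpha_0,\dots,\alpha_m\}$. Let $\sigma_r\in W$ be the orthogonal reflection in the plane $r^\perp$, put $\sigma_j=\sigma_{\alpha_j}$, and let $\kappa:R\to\mathbb C$ be $W$-invariant. Let $W$ act on $\mathbb C[x_1,x_2,x_3]$ by $(wf)(x)=f(w^{-1}x)$, and let the Dunkl operators be $$D_if=\partial_{x_i}f+\sum_{r\in R_+}\kappa(r)\,\langle\xi_i,r\rangle\,\frac{f-\sigma_rf}{\langle x,r\rangle},\qquad i=1,2,3,$$ where $\xi_1,\xi_2,\xi_3$ is the standard basis of $\mathbb R^3$. Let $\mathcal A\subset\operatorname{End}_{\mathbb C}(\mathbb C[x_1,x_2,x_3])$ be the algebra generated by $W$, the multiplication operators $x_1,x_2,x_3$ and $D_1,D_2,D_3$. Let $Cl(3)$ be the complex Clifford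 algebra with generators $e_1,e_2,e_3$, $e_i^2=1$, $e_ie_j=-e_je_i$ for $i\ne j$. In $Cl(3)\otimes\mathcal A$, with $[a,b]=ab-ba$ and $\{a,b\}=ab+ba$, put $\underline D=\sum_je_jD_j$, $\underline x=\sum_je_jx_j$, $\tilde\sigma_j=\big(\sum_i\langle\alpha_j,\xi_i\rangle e_i\big)\sigma_j$ for $0\le j\le m$, and $$O_i=\tfrac12([\underline D,x_i]-e_i),\qquad O_{ij}=x_iD_j-x_jD_i+\tfrac12e_ie_j+O_ie_j-O_je_i,\qquad O_{123}=\tfrac12([\underline D,\underline x]-1)e_1e_2e_3,$$ $$O_0=-i\,O_{12},\qquad O_+=i\,O_{31}+O_{23},\qquad O_-=i\,O_{31}-O_{23},$$ $$T_0=i\kappa(\alpha_0)\tilde\sigma_0,\qquad T_+=-i\sum_{j=1}^m\kappa(\alpha_j)e^{j\pi i/m}\tilde\sigma_j,\qquad T_-=i\sum_{j=1}^m\kappa(\alpha_j)e^{-j\pi i/m}\tilde\sigma_j.$$ **Proposition.** The elements $L_+=\tfrac12\{O_0,O_+\}$ and $L_-=\tfrac12\{O_0,O_-\}$ form a pair of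 ladder operators for $O_0$: $$[O_0,L_+]=L_+,\qquad [O_0,L_-]=-L_-.$$ Furthermore, they have the factorisations $$L_+L_-=-\big((O_0-\tfrac12)^2+(O_{123}+T_0)^2\big)\big((O_0-\tfrac12)^2-T_+T_-\big),$$ $$L_-L_+=-\big((O_0+\tfrac12)^2+(O_{123}-T_0)^2\big)\big((O_0+\tfrac12)^2-T_-T_+\big).$$ -/

import Mathlib

open scoped TensorProduct

noncomputable section

namespace DihedralDunkl

/-- Euclidean three-space. Coordinates are numbered `0, 1, 2` here, for `x₁, x₂, x₃`. -/
abbrev E3 : Type := EuclideanSpace ℝ (Fin 3)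

/-- The polynomial algebra `ℂ[x₁, x₂, x₃]`. -/
abbrev Poly : Type := MvPolynomial (Fin 3) ℂ

/-! ### Reflections and their action on polynomials -/

/-- The reflection `σ_r` in the plane orthogonal to `r`. -/
def refl (r : E3) : E3 ≃ₗᵢ[ℝ] E3 := (ℝ ∙ r)ᗮ.reflection

theorem refl_apply (r x : E3) :
    refl r x = x - (2 * inner ℝ x r / inner ℝ r r) • r := by
  rw [refl, Submodule.reflection_orthogonal_apply, Submodule.reflection_singleton_apply,
    real_inner_self_eq_norm_sq, real_inner_comm, neg_sub, two_smul, mul_div_assoc, two_mul,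
    add_smul]
  rfl

/-- The action `(w f)(x) = f(w⁻¹ x)` on polynomials: the variable `xᵢ` is replaced by the linear
form `x ↦ (w⁻¹ x)ᵢ`. -/
def act (w : E3 ≃ₗᵢ[ℝ] E3) : Poly →ₐ[ℂ] Poly :=
  MvPolynomial.aeval fun i =>
    ∑ j, MvPolynomial.C (((w⁻¹ (EuclideanSpace.single j 1)) i : ℝ) : ℂ) * MvPolynomial.X j

/-- The value of `w f` at a point is the value of `f` at the image of this point under `w⁻¹`. -/
theorem eval_act (w : E3 ≃ₗᵢ[ℝ] E3) (f : Poly) (x : E3) :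
    MvPolynomial.eval (fun i => ((x i : ℝ) : ℂ)) (act w f) =
      MvPolynomial.eval (fun i => (((w⁻¹ x) i : ℝ) : ℂ)) f := by
  have hx : ∀ i, (w⁻¹ x) i = ∑ j, (w⁻¹ (EuclideanSpace.single j 1)) i * x j := by
    intro i
    have h : x = ∑ j, x j • EuclideanSpace.single j (1 : ℝ) := by
      ext k
      simp [Pi.single_apply]
    conv_lhs => rw [h]
    simp [mul_comm]
  induction f using MvPolynomial.induction_on with
  | C a => simp [act]
  | add p q hp hq => simp only [map_add, hp, hq]
  | mul_X p i hp =>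
    simp only [map_mul, hp]
    congr 1
    rw [MvPolynomial.eval_X, hx]
    simp [act]

/-- The linear form `x ↦ ⟨x, r⟩` as a polynomial. -/
def linForm (r : E3) : Poly := ∑ i, MvPolynomial.C ((r i : ℝ) : ℂ) * MvPolynomial.X i

theorem linForm_ne_zero {r : E3} (hr : r ≠ 0) : linForm r ≠ 0 := by
  intro h
  apply hr
  ext i
  have := congrArg (MvPolynomial.eval (Pi.single i (1 : ℂ))) h
  simpa [linForm, Pi.single_apply] using this

/-- `f - σ_r f` is divisible by `⟨x, r⟩`. -/
theorem linForm_dvd (r : E3) (f : Poly) : linForm r ∣ f - act (refl r) f := by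
  rw [← Ideal.mem_span_singleton, ← Ideal.Quotient.mk_eq_mk_iff_sub_mem]
  have key : (Ideal.Quotient.mkₐ ℂ (Ideal.span {linForm r})) =
      (Ideal.Quotient.mkₐ ℂ (Ideal.span {linForm r})).comp (act (refl r)) := by
    apply MvPolynomial.algHom_ext
    intro i
    rw [AlgHom.comp_apply, Ideal.Quotient.mkₐ_eq_mk, Ideal.Quotient.mk_eq_mk_iff_sub_mem,
      Ideal.mem_span_singleton]
    have hinv : (refl r)⁻¹ = refl r := by
      change (refl r).symm = refl r
      exact Submodule.reflection_symm
    refine ⟨MvPolynomial.C (((2 / inner ℝ r r * r i : ℝ)) : ℂ), ?_⟩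
    have hX : (MvPolynomial.X i : Poly) =
        ∑ j, MvPolynomial.C (((EuclideanSpace.single j (1 : ℝ) : E3) i : ℝ) : ℂ) *
          MvPolynomial.X j := by
      simp [apply_ite]
    rw [act, MvPolynomial.aeval_X, hinv, linForm, Finset.sum_mul]
    nth_rewrite 1 [hX]
    rw [← Finset.sum_sub_distrib]
    refine Finset.sum_congr rfl fun j _ => ?_
    have hj : inner ℝ (EuclideanSpace.single j (1 : ℝ)) r = r j := by
      simp [EuclideanSpace.inner_single_left]
    rw [refl_apply, hj, ← sub_mul, ← MvPolynomial.C_sub, mul_right_comm, ← MvPolynomial.C_mul]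
    congr 2
    simp only [PiLp.sub_apply, PiLp.smul_apply, smul_eq_mul]
    push_cast
    ring
  exact DFunLike.congr_fun key f

theorem exists_divDiff (r : E3) :
    ∃ L : Poly →ₗ[ℂ] Poly, ∀ f, linForm r * L f = f - act (refl r) f := by
  by_cases hr : r = 0
  · refine ⟨0, fun f => ?_⟩
    have h := linForm_dvd r f
    have h0 : linForm r = 0 := by simp [hr, linForm]
    rw [h0, zero_dvd_iff] at h
    rw [h, h0, zero_mul]
  · choose q hq using linForm_dvd r
    have hc : ∀ {a b : Poly}, linForm r * a = linForm r * b → a = b :=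
      fun h => mul_left_cancel₀ (linForm_ne_zero hr) h
    refine ⟨{ toFun := q, map_add' := fun f g => hc ?_, map_smul' := fun c f => hc ?_ },
      fun f => (hq f).symm⟩
    · rw [mul_add, ← hq, ← hq, ← hq, map_add]; ring
    · rw [RingHom.id_apply, mul_smul_comm, ← hq, ← hq, map_smul, smul_sub]

/-- The operator `f ↦ (f - σ_r f) / ⟨x, r⟩` on polynomials (for `r ≠ 0` the quotient is unique). -/
def divDiff (r : E3) : Poly →ₗ[ℂ] Poly := (exists_divDiff r).choose

theorem linForm_mul_divDiff (r : E3) (f : Poly) :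
    linForm r * divDiff r f = f - act (refl r) f := (exists_divDiff r).choose_spec f

/-! ### The root system `A₁ ⊕ I₂(m)`, its reflection group and the Dunkl operators -/

/-- The roots `α₀ = (0, 0, 1)` and `αⱼ = (sin (jπ/m), -cos (jπ/m), 0)` for `j ≥ 1`. -/
def root (m j : ℕ) : E3 :=
  if j = 0 then !₂[0, 0, 1]
  else !₂[Real.sin (j * Real.pi / m), -Real.cos (j * Real.pi / m), 0]

/-- The root system `R = {±α₀, α₁, …, α₂ₘ}`; the positive roots are `α₀, α₁, …, αₘ`. -/
def rootSystem (m : ℕ) : Set E3 :=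
  {root m 0, -root m 0} ∪ {r | ∃ j, 1 ≤ j ∧ j ≤ 2 * m ∧ r = root m j}

/-- The reflection group `W = ℤ₂ × D₂ₘ`, generated by the reflections in the roots. -/
def reflGroup (m : ℕ) : Subgroup (E3 ≃ₗᵢ[ℝ] E3) :=
  Subgroup.closure (refl '' rootSystem m)

/-- `κ` is constant on the `W`-orbits of roots. Only the values of `κ` on the roots matter. -/
def IsInvariant (m : ℕ) (κ : E3 → ℂ) : Prop :=
  ∀ w ∈ reflGroup m, ∀ r ∈ rootSystem m, κ (w r) = κ r

/-- The Dunkl operator `Dᵢ f = ∂ᵢ f + ∑_{r > 0} κ(r) ⟨ξᵢ, r⟩ (f - σ_r f) / ⟨x, r⟩`. -/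
def dunkl (m : ℕ) (κ : E3 → ℂ) (i : Fin 3) : Module.End ℂ Poly :=
  (MvPolynomial.pderiv i : Derivation ℂ Poly Poly).toLinearMap +
    ∑ j ∈ Finset.range (m + 1), (κ (root m j) * ((root m j i : ℝ) : ℂ)) • divDiff (root m j)

/-- The operator of multiplication by `xᵢ`. -/
def mulX (i : Fin 3) : Module.End ℂ Poly := LinearMap.mulLeft ℂ (MvPolynomial.X i)

/-- The algebra `𝒜` of operators on polynomials generated by `W`, the Dunkl operators and the
multiplications by the variables. -/
def dunklAlgebra (m : ℕ) (κ : E3 → ℂ) : Subalgebra ℂ (Module.End ℂ Poly) :=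
  Algebra.adjoin ℂ ((fun w => (act w).toLinearMap) '' (reflGroup m : Set (E3 ≃ₗᵢ[ℝ] E3)) ∪
    Set.range (dunkl m κ) ∪ Set.range mulX)

/-- The root `αⱼ` for `j ≤ m` (a positive root) is a root. -/
theorem root_mem (m : ℕ) (j : ℕ) (hj : j ≤ m) : root m j ∈ rootSystem m := by
  rcases Nat.eq_zero_or_pos j with rfl | h
  · exact Or.inl (Or.inl rfl)
  · exact Or.inr ⟨j, h, by omega, rfl⟩

/-! ### The tensor product `Cl(3) ⊗ 𝒜` -/

/-- The quadratic form `v₁² + v₂² + v₃²` on `ℂ³`. -/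
def quadForm : QuadraticForm ℂ (Fin 3 → ℂ) :=
  QuadraticMap.weightedSumSquares ℂ fun _ : Fin 3 => (1 : ℂ)

/-- The algebra `Cl(3) ⊗ 𝒜`, where `Cl(3)` is the Clifford algebra with `eⱼ² = 1`. -/
abbrev ClA (m : ℕ) (κ : E3 → ℂ) : Type :=
  CliffordAlgebra quadForm ⊗[ℂ] dunklAlgebra m κ

variable (m : ℕ) (κ : E3 → ℂ)

/-- The Clifford generator `eᵢ`. -/
def e (i : Fin 3) : ClA m κ := CliffordAlgebra.ι quadForm (Pi.single i 1) ⊗ₜ[ℂ] 1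

/-- The multiplication operator `xᵢ`, as an element of `Cl(3) ⊗ 𝒜`. -/
def x (i : Fin 3) : ClA m κ :=
  1 ⊗ₜ[ℂ] ⟨mulX i, Algebra.subset_adjoin (Or.inr ⟨i, rfl⟩)⟩

/-- The Dunkl operator `Dᵢ`, as an element of `Cl(3) ⊗ 𝒜`. -/
def D (i : Fin 3) : ClA m κ :=
  1 ⊗ₜ[ℂ] ⟨dunkl m κ i, Algebra.subset_adjoin (Or.inl (Or.inr ⟨i, rfl⟩))⟩

/-- The element `w` of the reflection group, as an element of `Cl(3) ⊗ 𝒜`. -/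
def grp (w : reflGroup m) : ClA m κ :=
  1 ⊗ₜ[ℂ] ⟨(act w.1).toLinearMap, Algebra.subset_adjoin (Or.inl (Or.inl ⟨w.1, w.2, rfl⟩))⟩

/-- The reflection `σⱼ` in the positive root `αⱼ`, `0 ≤ j ≤ m`, as an element of `W`. -/
def sigma (j : Fin (m + 1)) : reflGroup m :=
  ⟨refl (root m j), Subgroup.subset_closure
    ⟨root m j, root_mem m j (Nat.lt_succ_iff.mp j.2), rfl⟩⟩

/-- The element `σ̃ⱼ = (∑ᵢ ⟨αⱼ, ξᵢ⟩ eᵢ) σⱼ` of the double covering of `W`. -/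
def sigmaTilde (j : Fin (m + 1)) : ClA m κ :=
  (∑ i, ((root m j i : ℝ) : ℂ) • e m κ i) * grp m κ (sigma m j)

/-- The Dunkl–Dirac operator `∑ eⱼ Dⱼ`. -/
def dirac : ClA m κ := ∑ j, e m κ j * D m κ j

/-- The vector variable `∑ eⱼ xⱼ`. -/
def vecX : ClA m κ := ∑ j, e m κ j * x m κ j

/-! ### The symmetries -/

/-- The one-index symmetry `Oᵢ = ½ ([D, xᵢ] - eᵢ)`, with `D` the Dunkl–Dirac operator. -/
def O1 (i : Fin 3) : ClA m κ :=
  (1 / 2 : ℂ) • (dirac m κ * x m κ i - x m κ i * dirac m κ - e m κ i)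

/-- The two-index symmetry `Oᵢⱼ = xᵢ Dⱼ - xⱼ Dᵢ + ½ eᵢ eⱼ + Oᵢ eⱼ - Oⱼ eᵢ`. -/
def O2 (i j : Fin 3) : ClA m κ :=
  (x m κ i * D m κ j - x m κ j * D m κ i) + (1 / 2 : ℂ) • (e m κ i * e m κ j)
    + O1 m κ i * e m κ j - O1 m κ j * e m κ i

/-- The three-index symmetry `O₁₂₃ = ½ ([D, x] - 1) e₁ e₂ e₃`, with `D` the Dunkl–Dirac operator
and `x` the vector variable. -/
def O123 : ClA m κ :=
  (1 / 2 : ℂ) • ((dirac m κ * vecX m κ - vecX m κ * dirac m κ - 1) *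
    (e m κ 0 * e m κ 1 * e m κ 2))

/-- `O₀ = -i O₁₂`. -/
def O0 : ClA m κ := -(Complex.I • O2 m κ 0 1)

/-- `O₊ = i O₃₁ + O₂₃`. -/
def Oplus : ClA m κ := Complex.I • O2 m κ 2 0 + O2 m κ 1 2

/-- `O₋ = i O₃₁ - O₂₃`. -/
def Ominus : ClA m κ := Complex.I • O2 m κ 2 0 - O2 m κ 1 2

/-- `T₀ = i κ(α₀) σ̃₀`. -/
def T0 : ClA m κ := (Complex.I * κ (root m 0)) • sigmaTilde m κ 0

/-- `T₊ = -i ∑_{j=1}^m κ(αⱼ) e^{jπi/m} σ̃ⱼ`; the summation index `j : Fin m` stands for `j + 1`. -/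
def Tplus : ClA m κ :=
  -(Complex.I • ∑ j : Fin m, (κ (root m ((j : ℕ) + 1)) *
    Complex.exp ((((j : ℕ) : ℂ) + 1) * Real.pi * Complex.I / m)) • sigmaTilde m κ j.succ)

/-- `T₋ = i ∑_{j=1}^m κ(αⱼ) e^{-jπi/m} σ̃ⱼ`; the summation index `j : Fin m` stands for `j + 1`. -/
def Tminus : ClA m κ :=
  Complex.I • ∑ j : Fin m, (κ (root m ((j : ℕ) + 1)) *
    Complex.exp (-((((j : ℕ) : ℂ) + 1) * Real.pi * Complex.I / m))) • sigmaTilde m κ j.succ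

/-- The ladder operator `L₊ = ½ {O₀, O₊}`. -/
def Lplus : ClA m κ := (1 / 2 : ℂ) • (O0 m κ * Oplus m κ + Oplus m κ * O0 m κ)

/-- The ladder operator `L₋ = ½ {O₀, O₋}`. -/
def Lminus : ClA m κ := (1 / 2 : ℂ) • (O0 m κ * Ominus m κ + Ominus m κ * O0 m κ)

/-- The scalar `1/2` in `Cl(3) ⊗ 𝒜`. -/
def half : ClA m κ := algebraMap ℂ (ClA m κ) (1 / 2)

end DihedralDunkl

end

/-!
The proof works in any ring that contains Clifford generators `e₁, e₂, e₃` and operators `xᵢ`,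
`Dᵢ`, `σ_r` with the relations of Dunkl operators (`DunklRelations`).

That the actual operators satisfy these relations (`dunklRelations`) rests on two facts, the
equivariance (`reflOp_mul_dunkl`) and the commutativity (`dunkl_comm`) of the Dunkl operators. Both
follow from the principle that an operator on polynomials vanishes if it kills the constants and
its kernel is stable under multiplication by the coordinates (`end_eq_zero`), because the
commutators `[Dᵢ, xⱼ]` are explicit sums of reflections, on which the reflections act by
conjugation, permuting the positive roots up to sign (`sum_root_refl`).

Let `Mᵢ` be the Dunkl angular momenta and `J = e₁e₂e₃`, which commutes with all `eᵢ` and satisfies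
`J² = -1`. The element `P = ½ + ∑ κ(r) σ_r - e₂e₃M₁ - e₃e₁M₂ - e₁e₂M₃` (`spin`) organises the
symmetries: `O₁₂₃ = J(P + ½)`, and the two-index symmetry belonging to the indices other than `i`
is `J(½{P, eᵢ} - Oᵢ)` (`twoSym_eq`). The commutation relations of the `Mᵢ` say that `P²` is free of
Clifford elements (`spinElement_mul_self`), so that `{P, eᵢ}` commutes with `P`; and the `Oᵢ` are
combinations of the elements `σ̃_r`, which commute with `P` as well. Hence `O₁₂₃` is central in the
algebra of the symmetries (`threeSym_comm_oneSym`, `threeSym_comm_twoSym`), and one obtains the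
commutators of the two-index symmetries (`twoSym_commutator`) and the sum of their squares
(`twoSym_casimir`).

For the root systems at hand each root lies on the third axis or in the plane orthogonal to it
(`IsSplit`). Therefore `O₃` commutes with `O₁₂` and anticommutes with `O₁`, `O₂`, `O₂₃`, `O₃₁`,
while `O₁` and `O₂` anticommute with `O₁₂`, and `(O₁ - iO₂)(e₁ + ie₂) = (e₁ - ie₂)(O₁ + iO₂)`.
Since `T₀ = iO₃` and `T± = O₁ ± iO₂`, this gives
`[O₀, O₊] = O₊ + 2(O₁₂₃ + T₀)T₊` with the last term anticommuting with `O₀`, so that the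
symmetrised product `½{O₀, O₊}` is a raising operator (`ladder_commutator`), and the product
`O₊O₋` is known from the sum of squares, from which the factorisation follows
(`ladder_mul_ladder`). The statements for `O₋` are those for `O₊` after the substitution
`O₀ ↦ -O₀`, `O₊ ↔ O₋`, `T₀ ↦ -T₀`, `T₊ ↦ -T₋`, `T₋ ↦ -T₊`, which preserves all the relations.
-/

noncomputable section

namespace DihedralDunkl

/-! ### Reflections acting on polynomials -/

theorem inner_eq_sum (r s : E3) : inner ℝ r s = ∑ i, r i * s i := by
  simp [PiLp.inner_apply, mul_comm]

theorem refl_inv (r : E3) : (refl r)⁻¹ = refl r := by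
  change (refl r).symm = refl r
  exact Submodule.reflection_symm

theorem refl_apply_of_unit {r : E3} (hr : inner ℝ r r = 1) (v : E3) :
    refl r v = v - (2 * inner ℝ v r) • r := by
  rw [refl_apply, hr, div_one]

theorem refl_neg (r : E3) : refl (-r) = refl r := by
  refine LinearIsometryEquiv.ext fun v => ?_
  rw [refl_apply, refl_apply, inner_neg_right, inner_neg_neg, smul_neg, ← neg_smul, mul_neg,
    neg_div, neg_neg]

theorem linForm_sub (r s : E3) : linForm (r - s) = linForm r - linForm s := by
  simp [linForm, sub_mul, Finset.sum_sub_distrib]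

theorem linForm_smul (a : ℝ) (r : E3) :
    linForm (a • r) = MvPolynomial.C ((a : ℝ) : ℂ) * linForm r := by
  simp [linForm, Finset.mul_sum, mul_assoc]

theorem linForm_single (i : Fin 3) :
    linForm (EuclideanSpace.single i 1) = MvPolynomial.X i := by
  simp [linForm, apply_ite]

/-- Reflections permute the linear forms in the same way as the vectors defining them. -/
theorem act_refl_linForm {r : E3} (hr : inner ℝ r r = 1) (v : E3) :
    act (refl r) (linForm v) = linForm (refl r v) := by
  have hX : ∀ i, act (refl r) (MvPolynomial.X i) =
      linForm (refl r (EuclideanSpace.single i 1)) := by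
    intro i
    rw [act, MvPolynomial.aeval_X, refl_inv, linForm]
    refine Finset.sum_congr rfl fun j _ => ?_
    congr 3
    rw [refl_apply_of_unit hr, refl_apply_of_unit hr]
    simp only [EuclideanSpace.inner_single_left, PiLp.sub_apply, PiLp.smul_apply, smul_eq_mul,
      PiLp.single_apply, map_one, one_mul]
    simp only [eq_comm (a := i) (b := j)]
    ring
  have hv : v = ∑ i, v i • EuclideanSpace.single i (1 : ℝ) := by
    ext k
    simp [Pi.single_apply]
  have hsum : ∀ w : Fin 3 → E3, linForm (∑ i, v i • w i) =
      ∑ i, MvPolynomial.C ((v i : ℝ) : ℂ) * linForm (w i) := by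
    intro w
    simp only [linForm, Fin.sum_univ_three, PiLp.add_apply, PiLp.smul_apply, smul_eq_mul,
      Complex.ofReal_add, Complex.ofReal_mul, map_add, map_mul]
    ring
  conv_rhs => rw [hv, map_sum]
  simp only [map_smul]
  rw [hsum, linForm, map_sum]
  refine Finset.sum_congr rfl fun i _ => ?_
  rw [map_mul, hX, ← MvPolynomial.algebraMap_eq, AlgHom.commutes]

theorem act_refl_X {r : E3} (hr : inner ℝ r r = 1) (i : Fin 3) :
    act (refl r) (MvPolynomial.X i) =
      MvPolynomial.X i - MvPolynomial.C (2 * ((r i : ℝ) : ℂ)) * linForm r := by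
  rw [← linForm_single, act_refl_linForm hr, refl_apply_of_unit hr, linForm_sub, linForm_smul]
  simp [EuclideanSpace.inner_single_left]

/-- The operator `σ_r` on polynomials. -/
def reflOp (r : E3) : Module.End ℂ Poly := (act (refl r)).toLinearMap

theorem reflOp_apply (r : E3) (f : Poly) : reflOp r f = act (refl r) f := rfl

theorem reflOp_neg (r : E3) : reflOp (-r) = reflOp r := by
  rw [reflOp, refl_neg, reflOp]

theorem inner_refl_refl (r v w : E3) : inner ℝ (refl r v) (refl r w) = inner ℝ v w :=
  LinearIsometryEquiv.inner_map_map _ _ _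

theorem act_refl_act_refl {r s : E3} (hr : inner ℝ r r = 1) (hs : inner ℝ s s = 1) (f : Poly) :
    act (refl s) (act (refl r) f) = act (refl (refl s r)) (act (refl s) f) := by
  have hsr : inner ℝ (refl s r) (refl s r) = 1 := by rw [inner_refl_refl, hr]
  have h : (act (refl s)).comp (act (refl r)) =
      (act (refl (refl s r))).comp (act (refl s)) := by
    apply MvPolynomial.algHom_ext
    intro i
    rw [AlgHom.comp_apply, AlgHom.comp_apply, ← linForm_single, act_refl_linForm hr,
      act_refl_linForm hs, act_refl_linForm hs, act_refl_linForm hsr]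
    congr 1
    rw [refl_apply_of_unit hr, refl_apply_of_unit hsr, inner_refl_refl, map_sub, map_smul]
  exact DFunLike.congr_fun h f

theorem reflOp_mul_reflOp {r s : E3} (hr : inner ℝ r r = 1) (hs : inner ℝ s s = 1) :
    reflOp s * reflOp r = reflOp (refl s r) * reflOp s :=
  LinearMap.ext fun f => act_refl_act_refl hr hs f

theorem reflOp_mul_mulX {r : E3} (hr : inner ℝ r r = 1) (i : Fin 3) :
    reflOp r * mulX i =
      (mulX i - (2 * ((r i : ℝ) : ℂ)) • ∑ j, ((r j : ℝ) : ℂ) • mulX j) * reflOp r := by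
  refine LinearMap.ext fun f => ?_
  simp only [Module.End.mul_apply, mulX, LinearMap.mulLeft_apply, reflOp_apply, map_mul,
    act_refl_X hr, LinearMap.sub_apply, LinearMap.smul_apply, LinearMap.sum_apply, linForm,
    MvPolynomial.smul_eq_C_mul, sub_mul, Finset.sum_mul, mul_assoc]

/-- The twisted Leibniz rule for the difference quotient, applied to a coordinate. -/
theorem divDiff_mul_mulX {r : E3} (hr : inner ℝ r r = 1) (i : Fin 3) :
    divDiff r * mulX i = mulX i * divDiff r + (2 * ((r i : ℝ) : ℂ)) • reflOp r := by
  refine LinearMap.ext fun f => ?_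
  have hr0 : r ≠ 0 := by
    rintro rfl
    simp at hr
  apply mul_left_cancel₀ (linForm_ne_zero hr0)
  simp only [Module.End.mul_apply, mulX, LinearMap.mulLeft_apply, LinearMap.add_apply,
    LinearMap.smul_apply, reflOp_apply, MvPolynomial.smul_eq_C_mul]
  rw [linForm_mul_divDiff, mul_add, mul_left_comm, linForm_mul_divDiff, map_mul, act_refl_X hr]
  ring

theorem divDiff_one {r : E3} (hr : inner ℝ r r = 1) : divDiff r 1 = 0 := by
  have hr0 : r ≠ 0 := by
    rintro rfl
    simp at hr
  apply mul_left_cancel₀ (linForm_ne_zero hr0)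
  rw [linForm_mul_divDiff, map_one, sub_self, mul_zero]

theorem pderiv_mul_mulX (i j : Fin 3) :
    ((MvPolynomial.pderiv i : Derivation ℂ Poly Poly).toLinearMap : Module.End ℂ Poly) * mulX j =
      mulX j * (MvPolynomial.pderiv i : Derivation ℂ Poly Poly).toLinearMap +
        (if i = j then 1 else 0) := by
  refine LinearMap.ext fun f => ?_
  simp only [Module.End.mul_apply, mulX, LinearMap.mulLeft_apply, LinearMap.add_apply,
    Derivation.coeFn_coe, Derivation.leibniz, MvPolynomial.pderiv_X, smul_eq_mul, Pi.single_apply]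
  split_ifs with h1 h2 <;> simp_all

theorem mulX_mul_mulX (i j : Fin 3) : mulX i * mulX j = mulX j * mulX i := by
  refine LinearMap.ext fun f => ?_
  simp only [Module.End.mul_apply, mulX, LinearMap.mulLeft_apply]
  ring

/-- A linear operator that kills the constants and whose kernel is stable under multiplication by
the coordinates is zero. -/
theorem end_eq_zero {E : Module.End ℂ Poly} (h1 : E 1 = 0)
    (hX : ∀ i f, E f = 0 → E (MvPolynomial.X i * f) = 0) : E = 0 := by
  refine LinearMap.ext fun f => ?_
  rw [LinearMap.zero_apply]
  induction f using MvPolynomial.induction_on with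
  | C a => rw [← mul_one (MvPolynomial.C a), ← MvPolynomial.smul_eq_C_mul, map_smul, h1, smul_zero]
  | add p q hp hq => rw [map_add, hp, hq, add_zero]
  | mul_X p i hp => rw [mul_comm]; exact hX i p hp

/-! ### Sums over the positive roots -/

/-- The planar root at the angle given by an arbitrary integer `j`; this agrees with `root m j`
for natural numbers `j ≥ 1`. -/
def planarRoot (m : ℕ) (j : ℤ) : E3 :=
  !₂[Real.sin (j * Real.pi / m), -Real.cos (j * Real.pi / m), 0]

theorem root_zero (m : ℕ) : root m 0 = EuclideanSpace.single 2 1 := by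
  ext i
  fin_cases i <;> simp [root]

theorem root_succ (m j : ℕ) : root m (j + 1) = planarRoot m (j + 1) := by
  simp [root, planarRoot]

theorem inner_planarRoot_self (m : ℕ) (j : ℤ) :
    inner ℝ (planarRoot m j) (planarRoot m j) = 1 := by
  simp only [inner_eq_sum, planarRoot, Fin.sum_univ_three]
  simp
  linarith [Real.sin_sq_add_cos_sq (j * Real.pi / m)]

theorem inner_root_self (m j : ℕ) : inner ℝ (root m j) (root m j) = 1 := by
  cases j with
  | zero => simp [root_zero]
  | succ j => rw [root_succ, inner_planarRoot_self]

theorem inner_root_zero_planarRoot (m : ℕ) (j : ℤ) :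
    inner ℝ (root m 0) (planarRoot m j) = 0 := by
  simp [root_zero, EuclideanSpace.inner_single_left, planarRoot]

theorem planarRoot_add {m : ℕ} (hm : m ≠ 0) (j : ℤ) :
    planarRoot m (j + m) = -planarRoot m j := by
  have h : ((j + m : ℤ) : ℝ) * Real.pi / m = j * Real.pi / m + Real.pi := by
    push_cast
    field_simp
  ext i
  simp only [planarRoot, h, Real.sin_add_pi, Real.cos_add_pi]
  fin_cases i <;> simp

/-- The reflection in a planar root reverses the cyclic order of the planar roots. -/
theorem refl_planarRoot (m : ℕ) (k j : ℤ) :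
    refl (planarRoot m k) (planarRoot m j) = -planarRoot m (2 * k - j) := by
  have h : ((2 * k - j : ℤ) : ℝ) * Real.pi / m =
      2 * (k * Real.pi / m) - j * Real.pi / m := by
    push_cast
    ring
  rw [refl_apply_of_unit (inner_planarRoot_self m k)]
  ext i
  simp only [inner_eq_sum, planarRoot, h, Fin.sum_univ_three, Real.sin_sub, Real.cos_sub,
    Real.sin_two_mul, Real.cos_two_mul]
  generalize (k * Real.pi / m : ℝ) = a
  generalize (j * Real.pi / m : ℝ) = b
  have ha := Real.sin_sq_add_cos_sq a
  fin_cases i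
  · simp
    linear_combination (-2 * Real.sin b) * ha
  · simp
    ring
  · simp

theorem planarRoot_mem {m : ℕ} (hm : m ≠ 0) (j : ℤ) : planarRoot m j ∈ rootSystem m := by
  have hper : Function.Periodic (planarRoot m) ((2 * m : ℕ) : ℤ) := by
    intro j
    push_cast
    rw [two_mul, ← add_assoc, planarRoot_add hm, planarRoot_add hm, neg_neg]
  have hpos : (0 : ℤ) < (2 * m : ℕ) := by omega
  obtain ⟨n, hn⟩ := Int.eq_ofNat_of_zero_le (Int.emod_nonneg (j - 1) hpos.ne')
  have hlt := Int.emod_lt_of_pos (j - 1) hpos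
  have hdiv := Int.emod_add_mul_ediv (j - 1) ((2 * m : ℕ) : ℤ)
  refine Or.inr ⟨n + 1, by omega, by omega, ?_⟩
  rw [root_succ, ← hn]
  have hj : j = (j - 1) % ((2 * m : ℕ) : ℤ) + 1 + (j - 1) / ((2 * m : ℕ) : ℤ) * (2 * m : ℕ) := by
    linarith
  conv_lhs => rw [hj]
  exact hper.int_mul _ _

theorem kappa_neg {m : ℕ} {κ : E3 → ℂ} (hκ : IsInvariant m κ) {r : E3} (hr : r ∈ rootSystem m) :
    κ (-r) = κ r := by
  rw [← hκ (refl r) (Subgroup.subset_closure ⟨r, hr, rfl⟩) r hr, refl,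
    Submodule.reflection_orthogonalComplement_singleton_eq_neg]

/-- Summing a periodic function over one period, in decreasing order from any starting point. -/
theorem sum_range_periodic {M : Type*} [AddCommGroup M] {m : ℕ} {G : ℤ → M}
    (hG : Function.Periodic G (m : ℤ)) (c : ℤ) :
    ∑ n ∈ Finset.range m, G (c - n) = ∑ n ∈ Finset.range m, G (n + 1) := by
  have hstep : ∀ c : ℤ, ∑ n ∈ Finset.range m, G (c + 1 - n) = ∑ n ∈ Finset.range m, G (c - n) := by
    intro c
    rcases m with _ | m
    · simp
    · rw [Finset.sum_range_succ', Finset.sum_range_succ]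
      congr 1
      · refine Finset.sum_congr rfl fun n _ => ?_
        congr 1
        push_cast
        ring
      · rw [← hG (c - m)]
        congr 1
        push_cast
        ring
  have hconst : ∀ c : ℤ, ∑ n ∈ Finset.range m, G (c - n) = ∑ n ∈ Finset.range m, G (m - n) := by
    intro c
    induction c using Int.inductionOn' (b := (m : ℤ)) with
    | zero => rfl
    | succ k _ ih => rw [hstep, ih]
    | pred k _ ih => rw [← ih, ← hstep, sub_add_cancel]
  rw [hconst, ← Finset.sum_range_reflect]
  refine Finset.sum_congr rfl fun n hn => ?_
  congr 1
  have := Finset.mem_range.mp hn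
  omega

/-- A sum over the positive roots of an even function is invariant under the reflections in the
roots. -/
theorem sum_root_refl {M : Type*} [AddCommGroup M] {m : ℕ} (hm : m ≠ 0) {F : E3 → M}
    (hF : ∀ r ∈ rootSystem m, F (-r) = F r) (k : ℕ) :
    ∑ n ∈ Finset.range (m + 1), F (refl (root m k) (root m n)) =
      ∑ n ∈ Finset.range (m + 1), F (root m n) := by
  rw [Finset.sum_range_succ', Finset.sum_range_succ']
  simp only [root_succ]
  cases k with
  | zero =>
    have h0 : refl (root m 0) (root m 0) = -root m 0 := by
      rw [refl, Submodule.reflection_orthogonalComplement_singleton_eq_neg]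
    rw [h0, hF _ (root_mem m 0 (Nat.zero_le m))]
    congr 1
    refine Finset.sum_congr rfl fun n _ => ?_
    rw [refl_apply_of_unit (inner_root_self m 0), real_inner_comm, inner_root_zero_planarRoot]
    simp
  | succ k =>
    have h0 : refl (planarRoot m (k + 1)) (root m 0) = root m 0 := by
      rw [refl_apply_of_unit (inner_planarRoot_self m _), inner_root_zero_planarRoot]
      simp
    rw [root_succ, h0]
    congr 1
    have hper : Function.Periodic (fun j => F (planarRoot m j)) (m : ℤ) := by
      intro j
      simp only [planarRoot_add hm]
      exact hF _ (planarRoot_mem hm j)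
    rw [← sum_range_periodic hper (2 * (k + 1) - 1)]
    refine Finset.sum_congr rfl fun n _ => ?_
    rw [refl_planarRoot, hF _ (planarRoot_mem hm _)]
    congr 2
    ring

/-! ### Relations between the Dunkl operators, the coordinates and the reflections -/

/-- Multiplication by the linear form `⟨·, v⟩`. -/
def mulLin (v : E3) : Module.End ℂ Poly := ∑ i, ((v i : ℝ) : ℂ) • mulX i

/-- The Dunkl operator in the direction `v`. -/
def dunklAt (m : ℕ) (κ : E3 → ℂ) (v : E3) : Module.End ℂ Poly :=
  ∑ i, ((v i : ℝ) : ℂ) • dunkl m κ i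

/-- The commutator of the Dunkl operator in the direction `v` with the linear form `⟨·, w⟩`. -/
def commAt (m : ℕ) (κ : E3 → ℂ) (v w : E3) : Module.End ℂ Poly :=
  ((inner ℝ v w : ℝ) : ℂ) • 1 + ∑ n ∈ Finset.range (m + 1),
    (2 * κ (root m n) * ((inner ℝ v (root m n) : ℝ) : ℂ) * ((inner ℝ w (root m n) : ℝ) : ℂ)) •
      reflOp (root m n)

variable {m : ℕ} {κ : E3 → ℂ}

theorem dunkl_mul_mulX (i j : Fin 3) :
    dunkl m κ i * mulX j = mulX j * dunkl m κ i + ((if i = j then 1 else 0) +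
      ∑ n ∈ Finset.range (m + 1),
        (2 * κ (root m n) * ((root m n i : ℝ) : ℂ) * ((root m n j : ℝ) : ℂ)) •
          reflOp (root m n)) := by
  simp only [dunkl, add_mul, mul_add, Finset.sum_mul, Finset.mul_sum, smul_mul_assoc,
    mul_smul_comm, pderiv_mul_mulX, divDiff_mul_mulX (inner_root_self _ _), smul_add,
    Finset.sum_add_distrib, smul_smul]
  have : ∀ n, κ (root m n) * ((root m n i : ℝ) : ℂ) * (2 * ((root m n j : ℝ) : ℂ)) =
      2 * κ (root m n) * ((root m n i : ℝ) : ℂ) * ((root m n j : ℝ) : ℂ) := fun n => by ring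
  simp only [this]
  abel

theorem dunkl_one (i : Fin 3) : dunkl m κ i 1 = 0 := by
  simp [dunkl, LinearMap.sum_apply, divDiff_one (inner_root_self _ _)]

theorem dunklAt_one (v : E3) : dunklAt m κ v 1 = 0 := by
  simp [dunklAt, LinearMap.sum_apply, dunkl_one]

theorem mulLin_single (i : Fin 3) : mulLin (EuclideanSpace.single i 1) = mulX i := by
  simp [mulLin, apply_ite]

theorem dunklAt_single (i : Fin 3) :
    dunklAt m κ (EuclideanSpace.single i 1) = dunkl m κ i := by
  simp [dunklAt, apply_ite]

theorem dunklAt_sub_smul (v w : E3) (a : ℝ) :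
    dunklAt m κ (v - a • w) = dunklAt m κ v - (a : ℂ) • dunklAt m κ w := by
  simp only [dunklAt, Fin.sum_univ_three, PiLp.sub_apply, PiLp.smul_apply, smul_eq_mul,
    Complex.ofReal_sub, Complex.ofReal_mul]
  module

theorem mulLin_sub_smul (v w : E3) (a : ℝ) :
    mulLin (v - a • w) = mulLin v - (a : ℂ) • mulLin w := by
  simp only [mulLin, Fin.sum_univ_three, PiLp.sub_apply, PiLp.smul_apply, smul_eq_mul,
    Complex.ofReal_sub, Complex.ofReal_mul]
  module

theorem dunklAt_mul_mulLin (v w : E3) :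
    dunklAt m κ v * mulLin w = mulLin w * dunklAt m κ v + commAt m κ v w := by
  have hδ : ((inner ℝ v w : ℝ) : ℂ) • (1 : Module.End ℂ Poly) =
      ∑ i, ∑ j, ((v i : ℝ) : ℂ) • ((w j : ℝ) : ℂ) • (if i = j then 1 else 0) := by
    simp [inner_eq_sum, smul_smul, Finset.sum_smul]
  have hr : ∀ r : E3, ∀ a : ℂ, ∀ T : Module.End ℂ Poly,
      (2 * a * ((inner ℝ v r : ℝ) : ℂ) * ((inner ℝ w r : ℝ) : ℂ)) • T =
      ∑ i, ∑ j, ((v i : ℝ) : ℂ) • ((w j : ℝ) : ℂ) •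
        (2 * a * ((r i : ℝ) : ℂ) * ((r j : ℝ) : ℂ)) • T := by
    intro r a T
    simp only [smul_smul, ← Finset.sum_smul, inner_eq_sum]
    congr 1
    push_cast
    rw [mul_assoc, Finset.sum_mul_sum, Finset.mul_sum]
    refine Finset.sum_congr rfl fun i _ => ?_
    rw [Finset.mul_sum]
    refine Finset.sum_congr rfl fun j _ => ?_
    ring
  have hswap : mulLin w * dunklAt m κ v =
      ∑ i, ∑ j, ((v i : ℝ) : ℂ) • ((w j : ℝ) : ℂ) • (mulX j * dunkl m κ i) := by
    simp only [mulLin, dunklAt, Fin.sum_univ_three, add_mul, mul_add, smul_mul_assoc,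
      mul_smul_comm]
    module
  have hL : dunklAt m κ v * mulLin w =
      ∑ i, ∑ j, ((v i : ℝ) : ℂ) • ((w j : ℝ) : ℂ) • (dunkl m κ i * mulX j) := by
    simp only [mulLin, dunklAt, Fin.sum_univ_three, add_mul, mul_add, smul_mul_assoc,
      mul_smul_comm]
    module
  have hC : commAt m κ v w =
      ∑ i, ∑ j, ((v i : ℝ) : ℂ) • ((w j : ℝ) : ℂ) • ((if i = j then 1 else 0) +
        ∑ n ∈ Finset.range (m + 1),
          (2 * κ (root m n) * ((root m n i : ℝ) : ℂ) * ((root m n j : ℝ) : ℂ)) •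
            reflOp (root m n)) := by
    simp only [commAt, hδ, hr, smul_add, Finset.sum_add_distrib, Finset.smul_sum]
    congr 1
    rw [Finset.sum_comm]
    exact Finset.sum_congr rfl fun i _ => Finset.sum_comm
  rw [hL, hswap, hC]
  simp only [dunkl_mul_mulX, smul_add, Finset.sum_add_distrib]

theorem reflOp_mul_mulLin {r : E3} (hr : inner ℝ r r = 1) (v : E3) :
    reflOp r * mulLin v = mulLin (refl r v) * reflOp r := by
  rw [refl_apply_of_unit hr, mulLin_sub_smul]
  simp only [mulLin, Finset.mul_sum, mul_smul_comm, reflOp_mul_mulX hr]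
  simp only [sub_mul, Finset.sum_mul, smul_mul_assoc, smul_sub, Finset.sum_sub_distrib, smul_smul]
  congr 1
  rw [← Finset.sum_smul, inner_eq_sum]
  congr 1
  push_cast
  rw [Finset.mul_sum]
  refine Finset.sum_congr rfl fun i _ => ?_
  ring

/-- The reflections act diagonally on the commutators of Dunkl operators with linear forms. -/
theorem reflOp_mul_commAt (hm : m ≠ 0) (hκ : IsInvariant m κ) {k : ℕ} (hk : k ≤ m) (v w : E3) :
    reflOp (root m k) * commAt m κ v w =
      commAt m κ (refl (root m k) v) (refl (root m k) w) * reflOp (root m k) := by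
  have hs := inner_root_self m k
  have hinv : ∀ u, inner ℝ (refl (root m k) v) u = inner ℝ v (refl (root m k) u) := by
    intro u
    conv_rhs => rw [← inner_refl_refl (root m k)]
    rw [refl, Submodule.reflection_reflection]
  have hinw : ∀ u, inner ℝ (refl (root m k) w) u = inner ℝ w (refl (root m k) u) := by
    intro u
    conv_rhs => rw [← inner_refl_refl (root m k)]
    rw [refl, Submodule.reflection_reflection]
  have key := sum_root_refl (k := k) hm (F := fun r =>
    (2 * κ r * ((inner ℝ (refl (root m k) v) r : ℝ) : ℂ) *
      ((inner ℝ (refl (root m k) w) r : ℝ) : ℂ)) • reflOp r) (by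
    intro r hr
    simp [kappa_neg hκ hr, reflOp_neg])
  simp only [commAt]
  rw [inner_refl_refl, mul_add, add_mul, ← key, Finset.mul_sum, Finset.sum_mul]
  congr 1
  · simp
  · refine Finset.sum_congr rfl fun n hn => ?_
    have hn' : n ≤ m := Nat.lt_succ_iff.mp (Finset.mem_range.mp hn)
    rw [mul_smul_comm, smul_mul_assoc, reflOp_mul_reflOp (inner_root_self m n) hs,
      inner_refl_refl, inner_refl_refl,
      hκ _ (Subgroup.subset_closure ⟨_, root_mem m k hk, rfl⟩) _ (root_mem m n hn')]

/-- Equivariance of the Dunkl operators. The difference of the two sides commutes with the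
coordinates up to a twist and kills the constants. -/
theorem reflOp_mul_dunklAt (hm : m ≠ 0) (hκ : IsInvariant m κ) {k : ℕ} (hk : k ≤ m) (v : E3) :
    reflOp (root m k) * dunklAt m κ v =
      dunklAt m κ (refl (root m k) v) * reflOp (root m k) := by
  have hs := inner_root_self m k
  rw [← sub_eq_zero]
  apply end_eq_zero
  · simp [dunklAt_one, reflOp_apply]
  · intro i f hf
    have h : (reflOp (root m k) * dunklAt m κ v -
          dunklAt m κ (refl (root m k) v) * reflOp (root m k)) * mulX i =
        mulLin (refl (root m k) (EuclideanSpace.single i 1)) *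
          (reflOp (root m k) * dunklAt m κ v -
            dunklAt m κ (refl (root m k) v) * reflOp (root m k)) := by
      rw [← mulLin_single, sub_mul, mul_assoc, dunklAt_mul_mulLin, mul_add,
        reflOp_mul_commAt hm hκ hk, ← mul_assoc, reflOp_mul_mulLin hs, mul_assoc _ _ (mulLin _),
        reflOp_mul_mulLin hs, ← mul_assoc (dunklAt _ _ _), dunklAt_mul_mulLin, add_mul,
        mul_sub, mul_assoc, mul_assoc]
      abel
    have h' := LinearMap.congr_fun h f
    rw [Module.End.mul_apply, Module.End.mul_apply, hf, map_zero] at h'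
    exact h'

theorem dunklAt_mul_reflOp (hm : m ≠ 0) (hκ : IsInvariant m κ) {k : ℕ} (hk : k ≤ m) (v : E3) :
    dunklAt m κ v * reflOp (root m k) - reflOp (root m k) * dunklAt m κ v =
      (2 * ((inner ℝ v (root m k) : ℝ) : ℂ)) •
        (dunklAt m κ (root m k) * reflOp (root m k)) := by
  rw [reflOp_mul_dunklAt hm hκ hk, refl_apply_of_unit (inner_root_self m k), dunklAt_sub_smul,
    sub_mul, sub_sub_cancel, smul_mul_assoc]
  push_cast
  rfl

theorem dunklAt_mul_commAt (hm : m ≠ 0) (hκ : IsInvariant m κ) (u v w : E3) :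
    dunklAt m κ u * commAt m κ v w - commAt m κ v w * dunklAt m κ u =
      ∑ n ∈ Finset.range (m + 1), (4 * κ (root m n) * ((inner ℝ u (root m n) : ℝ) : ℂ) *
        ((inner ℝ v (root m n) : ℝ) : ℂ) * ((inner ℝ w (root m n) : ℝ) : ℂ)) •
          (dunklAt m κ (root m n) * reflOp (root m n)) := by
  rw [commAt, mul_add, add_mul, mul_smul_comm, smul_mul_assoc, mul_one, one_mul,
    add_sub_add_left_eq_sub, Finset.mul_sum, Finset.sum_mul, ← Finset.sum_sub_distrib]
  refine Finset.sum_congr rfl fun n hn => ?_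
  rw [mul_smul_comm, smul_mul_assoc]
  linear_combination (norm := module)
    (2 * κ (root m n) * ((inner ℝ v (root m n) : ℝ) : ℂ) * ((inner ℝ w (root m n) : ℝ) : ℂ)) •
      dunklAt_mul_reflOp hm hκ (Nat.lt_succ_iff.mp (Finset.mem_range.mp hn)) u

/-- The Dunkl operators commute: by the Jacobi identity their commutator commutes with the
coordinates, because `[D_u, [D_v, x_w]]` is symmetric in `u` and `v`; and it kills the
constants. -/
theorem dunklAt_comm (hm : m ≠ 0) (hκ : IsInvariant m κ) (u v : E3) :
    dunklAt m κ u * dunklAt m κ v = dunklAt m κ v * dunklAt m κ u := by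
  rw [← sub_eq_zero]
  apply end_eq_zero
  · simp [dunklAt_one]
  · intro i f hf
    have hsymm : dunklAt m κ u * commAt m κ v (EuclideanSpace.single i 1) -
        commAt m κ v (EuclideanSpace.single i 1) * dunklAt m κ u =
        dunklAt m κ v * commAt m κ u (EuclideanSpace.single i 1) -
        commAt m κ u (EuclideanSpace.single i 1) * dunklAt m κ v := by
      rw [dunklAt_mul_commAt hm hκ, dunklAt_mul_commAt hm hκ]
      refine Finset.sum_congr rfl fun n _ => ?_
      congr 1
      ring
    have h : (dunklAt m κ u * dunklAt m κ v - dunklAt m κ v * dunklAt m κ u) * mulX i =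
        mulX i * (dunklAt m κ u * dunklAt m κ v - dunklAt m κ v * dunklAt m κ u) := by
      have hu := dunklAt_mul_mulLin (m := m) (κ := κ) u (EuclideanSpace.single i 1)
      have hv := dunklAt_mul_mulLin (m := m) (κ := κ) v (EuclideanSpace.single i 1)
      rw [mulLin_single] at hu hv
      rw [sub_mul, mul_assoc, mul_assoc, hu, hv, mul_add, mul_add, ← mul_assoc, ← mul_assoc, hu,
        hv, add_mul, add_mul, mul_sub, mul_assoc, mul_assoc]
      rw [← sub_eq_zero] at hsymm ⊢
      rw [← hsymm]
      abel
    have h' := LinearMap.congr_fun h f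
    rw [Module.End.mul_apply, Module.End.mul_apply, hf, map_zero] at h'
    exact h'

theorem dunkl_comm (hm : m ≠ 0) (hκ : IsInvariant m κ) (i j : Fin 3) :
    dunkl m κ i * dunkl m κ j = dunkl m κ j * dunkl m κ i := by
  rw [← dunklAt_single, ← dunklAt_single, dunklAt_comm hm hκ]

theorem reflOp_mul_dunkl (hm : m ≠ 0) (hκ : IsInvariant m κ) {k : ℕ} (hk : k ≤ m) (i : Fin 3) :
    reflOp (root m k) * dunkl m κ i =
      (dunkl m κ i - (2 * ((root m k i : ℝ) : ℂ)) •
        ∑ j, ((root m k j : ℝ) : ℂ) • dunkl m κ j) * reflOp (root m k) := by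
  rw [← dunklAt_single, reflOp_mul_dunklAt hm hκ hk, refl_apply_of_unit (inner_root_self m k),
    dunklAt_sub_smul, EuclideanSpace.inner_single_left, dunklAt_single, dunklAt]
  simp

/-! ### Ladder operators from commutation relations -/

section Ladder

variable {B : Type*} [Ring B] [Algebra ℂ B]

/-- If `E` raises the eigenvalues of `H` up to a term anticommuting with `H`, then the symmetrised
product `½{H, E}` raises them exactly. -/
theorem ladder_commutator {H E Y : B} (hE : H * E - E * H = E + Y) (hY : H * Y = -(Y * H)) :
    H * ((1 / 2 : ℂ) • (H * E + E * H)) - ((1 / 2 : ℂ) • (H * E + E * H)) * H =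
      (1 / 2 : ℂ) • (H * E + E * H) := by
  have h1 : H * (H * E) - H * (E * H) = H * E + H * Y := by
    rw [← mul_sub, hE, mul_add]
  have h2 : H * (E * H) - E * (H * H) = E * H + Y * H := by
    rw [← mul_assoc, ← mul_assoc, ← sub_mul, hE, add_mul]
  simp only [mul_smul_comm, smul_mul_assoc, mul_add, add_mul, mul_assoc]
  linear_combination (norm := module) (1 / 2 : ℂ) • h1 + (1 / 2 : ℂ) • h2 + (1 / 2 : ℂ) • hY

/-- The factorisation of a product of two ladder operators. Here `E` and `F` raise and lower the
eigenvalues of `H` only up to terms in `U` and `V`, which the symmetrised products `½{H, E}` and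
`½{H, F}` cancel. -/
theorem ladder_mul_ladder {H E F W T U V : B}
    (hE : H * E - E * H = E + (2 : ℂ) • ((W + T) * U))
    (hF : H * F - F * H = -F + (2 : ℂ) • ((W - T) * V))
    (hEF : E * F = -((H - algebraMap ℂ B (1 / 2)) ^ 2) - (W + T) ^ 2 + U * V)
    (hUF : U * F = -(E * V))
    (hWH : W * H = H * W) (hWE : W * E = E * W) (hWU : W * U = U * W)
    (hTH : T * H = H * T) (hTE : T * E = -(E * T)) (hTU : T * U = -(U * T))
    (hHU : H * U = -(U * H)) (hHV : H * V = -(V * H)) :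
    (1 / 2 : ℂ) • (H * E + E * H) * ((1 / 2 : ℂ) • (H * F + F * H)) =
      -(((H - algebraMap ℂ B (1 / 2)) ^ 2 + (W + T) ^ 2) *
        ((H - algebraMap ℂ B (1 / 2)) ^ 2 - U * V)) := by
  obtain ⟨a, ha⟩ : ∃ a, a = H - algebraMap ℂ B (1 / 2) := ⟨_, rfl⟩
  obtain ⟨Z, hZ⟩ : ∃ Z, Z = W + T := ⟨_, rfl⟩
  have hH : H = a + (1 / 2 : ℂ) • 1 := by
    rw [ha, Algebra.algebraMap_eq_smul_one, sub_add_cancel]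
  rw [← ha, ← hZ] at hEF ⊢
  rw [← hZ] at hE
  -- In terms of `a = H - ½` the symmetrised products become one-sided products plus corrections.
  have hL : (1 / 2 : ℂ) • (H * E + E * H) = a * E - Z * U := by
    rw [hH] at hE ⊢
    simp only [mul_add, add_mul, smul_mul_assoc, mul_smul_comm, one_mul, mul_one] at hE ⊢
    linear_combination (norm := module) (-1 / 2 : ℂ) • hE
  have hL' : (1 / 2 : ℂ) • (H * F + F * H) = F * a + (W - T) * V := by
    rw [hH] at hF ⊢
    simp only [mul_add, add_mul, smul_mul_assoc, mul_smul_comm, one_mul, mul_one] at hF ⊢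
    linear_combination (norm := module) (1 / 2 : ℂ) • hF
  have hEZ : E * (W - T) = Z * E := by
    rw [hZ, mul_sub, add_mul, hWE, hTE]; abel
  have hUZ : U * (W - T) = Z * U := by
    rw [hZ, mul_sub, add_mul, hWU, hTU]; abel
  have haZ : a * Z = Z * a := by
    rw [ha, hZ, sub_mul, mul_sub, ← Algebra.commutes, mul_add, add_mul, hWH, hTH]
  have haUV : a * (U * V) = U * V * a := by
    rw [ha, sub_mul, mul_sub, ← Algebra.commutes, ← mul_assoc, hHU, neg_mul, mul_assoc, hHV,
      mul_neg, neg_neg, mul_assoc]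
  -- `E` moves past `a` at the cost of a term in `U`, which pairs with `V`.
  have hcross : a * (E * V) + E * (V * a) = (2 : ℂ) • (Z * (U * V)) := by
    have h1 := congrArg (· * V) hE
    have h2 := congrArg (E * ·) hHV
    rw [hH] at h1 h2
    simp only [sub_mul, mul_add, add_mul, smul_mul_assoc, mul_smul_comm, one_mul, mul_one,
      mul_assoc, mul_neg] at h1 h2 ⊢
    linear_combination (norm := module) h1 + h2
  have h1 : Z * a * (E * V) + Z * (E * V) * a = (2 : ℂ) • (Z * Z * (U * V)) := by
    have := congrArg (Z * ·) hcross
    simp only [mul_add, mul_smul_comm, mul_assoc] at this ⊢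
    exact this
  have h2 : a * (Z * Z) = Z * Z * a := by
    rw [← mul_assoc, haZ, mul_assoc, haZ, mul_assoc]
  calc (1 / 2 : ℂ) • (H * E + E * H) * ((1 / 2 : ℂ) • (H * F + F * H))
      = a * (E * F) * a + a * (E * (W - T)) * V - Z * (U * F) * a - Z * (U * (W - T)) * V := by
        rw [hL, hL']; noncomm_ring
    _ = -(a * a * a * a) - a * (Z * Z) * a + a * (U * V) * a + a * Z * (E * V)
          + Z * (E * V) * a - Z * Z * (U * V) := by
        rw [hEF, hEZ, hUF, hUZ]; noncomm_ring
    _ = -((a ^ 2 + Z ^ 2) * (a ^ 2 - U * V)) := by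
        have h3 : a * (U * V) * a = a * a * (U * V) := by rw [mul_assoc, ← haUV, mul_assoc]
        rw [h2, h3, haZ]
        simp only [pow_two, mul_sub, add_mul, mul_assoc] at h1 ⊢
        linear_combination (norm := module) h1

/-- The ladder relations and the factorisations, deduced from the commutation relations of the
two-index symmetries `A k`, the one-index symmetries `O k` and the central element `W`. -/
theorem ladder_of_relations {A1 A2 A3 O1 O2 O3 W : B}
    (hA12 : A1 * A2 - A2 * A1 = -(A3 + (2 : ℂ) • (W * O3) + (O1 * O2 - O2 * O1)))
    (hA23 : A2 * A3 - A3 * A2 = -(A1 + (2 : ℂ) • (W * O1) + (O2 * O3 - O3 * O2)))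
    (hA31 : A3 * A1 - A1 * A3 = -(A2 + (2 : ℂ) • (W * O2) + (O3 * O1 - O1 * O3)))
    (hcas : A1 * A1 + A2 * A2 + A3 * A3 =
      W * W + (1 / 4 : ℂ) • 1 - (O1 * O1 + O2 * O2 + O3 * O3))
    (hWA1 : W * A1 = A1 * W) (hWA2 : W * A2 = A2 * W) (hWA3 : W * A3 = A3 * W)
    (hWO1 : W * O1 = O1 * W) (hWO2 : W * O2 = O2 * W) (hWO3 : W * O3 = O3 * W)
    (hOA33 : O3 * A3 = A3 * O3) (hOA31 : O3 * A1 = -(A1 * O3)) (hOA32 : O3 * A2 = -(A2 * O3))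
    (hOO31 : O3 * O1 = -(O1 * O3)) (hOO32 : O3 * O2 = -(O2 * O3))
    (hAO31 : A3 * O1 = -(O1 * A3)) (hAO32 : A3 * O2 = -(O2 * A3))
    (hpm : (O1 + Complex.I • O2) * (Complex.I • A2 - A1) =
      -((Complex.I • A2 + A1) * (O1 - Complex.I • O2)))
    (hmp : (O1 - Complex.I • O2) * (Complex.I • A2 + A1) =
      -((Complex.I • A2 - A1) * (O1 + Complex.I • O2)))
    {H E F T U V : B} (hH : H = -(Complex.I • A3)) (hE : E = Complex.I • A2 + A1)
    (hF : F = Complex.I • A2 - A1) (hT : T = Complex.I • O3)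
    (hU : U = O1 + Complex.I • O2) (hV : V = O1 - Complex.I • O2) :
    (H * ((1 / 2 : ℂ) • (H * E + E * H)) - (1 / 2 : ℂ) • (H * E + E * H) * H =
      (1 / 2 : ℂ) • (H * E + E * H)) ∧
    (H * ((1 / 2 : ℂ) • (H * F + F * H)) - (1 / 2 : ℂ) • (H * F + F * H) * H =
      -((1 / 2 : ℂ) • (H * F + F * H))) ∧
    ((1 / 2 : ℂ) • (H * E + E * H) * ((1 / 2 : ℂ) • (H * F + F * H)) =
      -(((H - algebraMap ℂ B (1 / 2)) ^ 2 + (W + T) ^ 2) *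
        ((H - algebraMap ℂ B (1 / 2)) ^ 2 - U * V))) ∧
    ((1 / 2 : ℂ) • (H * F + F * H) * ((1 / 2 : ℂ) • (H * E + E * H)) =
      -(((H + algebraMap ℂ B (1 / 2)) ^ 2 + (W - T) ^ 2) *
        ((H + algebraMap ℂ B (1 / 2)) ^ 2 - V * U))) := by
  rw [← hU, ← hV, ← hE, ← hF] at hpm hmp
  have hWH : W * H = H * W := by
    rw [hH, mul_neg, neg_mul, mul_smul_comm, smul_mul_assoc, hWA3]
  have hWE : W * E = E * W := by
    rw [hE]; simp only [mul_add, add_mul, mul_smul_comm, smul_mul_assoc, hWA1, hWA2]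
  have hWF : W * F = F * W := by
    rw [hF]; simp only [mul_sub, sub_mul, mul_smul_comm, smul_mul_assoc, hWA1, hWA2]
  have hWU : W * U = U * W := by
    rw [hU]; simp only [mul_add, add_mul, mul_smul_comm, smul_mul_assoc, hWO1, hWO2]
  have hWV : W * V = V * W := by
    rw [hV]; simp only [mul_sub, sub_mul, mul_smul_comm, smul_mul_assoc, hWO1, hWO2]
  have hWT : W * T = T * W := by
    rw [hT, mul_smul_comm, smul_mul_assoc, hWO3]
  have hTH : T * H = H * T := by
    rw [hT, hH]
    simp only [mul_neg, neg_mul, mul_smul_comm, smul_mul_assoc, hOA33]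
    module
  have hTE : T * E = -(E * T) := by
    rw [hT, hE]
    simp only [mul_add, add_mul, mul_smul_comm, smul_mul_assoc, hOA31, hOA32]
    module
  have hTF : T * F = -(F * T) := by
    rw [hT, hF]
    simp only [mul_sub, sub_mul, mul_smul_comm, smul_mul_assoc, hOA31, hOA32]
    module
  have hTU : T * U = -(U * T) := by
    rw [hT, hU]
    simp only [mul_add, add_mul, mul_smul_comm, smul_mul_assoc, hOO31, hOO32]
    module
  have hTV : T * V = -(V * T) := by
    rw [hT, hV]
    simp only [mul_sub, sub_mul, mul_smul_comm, smul_mul_assoc, hOO31, hOO32]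
    module
  have hHU : H * U = -(U * H) := by
    rw [hH, hU]
    simp only [mul_add, add_mul, mul_neg, neg_mul, mul_smul_comm, smul_mul_assoc, hAO31, hAO32]
    module
  have hHV : H * V = -(V * H) := by
    rw [hH, hV]
    simp only [mul_sub, sub_mul, mul_neg, neg_mul, mul_smul_comm, smul_mul_assoc, hAO31, hAO32]
    module
  have hHE : H * E - E * H = E + (2 : ℂ) • ((W + T) * U) := by
    rw [hH, hE, hT, hU]
    simp only [mul_add, add_mul, mul_neg, neg_mul, mul_smul_comm, smul_mul_assoc, hOO31, hOO32,
      smul_add, smul_neg, smul_smul, Complex.I_mul_I] at hA23 hA31 ⊢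
    linear_combination (norm := module) (-1 : ℂ) • hA23 + (-Complex.I) • hA31
  have hHF : H * F - F * H = -F + (2 : ℂ) • ((W - T) * V) := by
    rw [hH, hF, hT, hV]
    simp only [mul_sub, sub_mul, mul_neg, neg_mul, mul_smul_comm, smul_mul_assoc, hOO31, hOO32,
      smul_sub, smul_neg, smul_smul, Complex.I_mul_I] at hA23 hA31 ⊢
    linear_combination (norm := module) (-1 : ℂ) • hA23 + Complex.I • hA31
  have hEF : E * F = -((H - algebraMap ℂ B (1 / 2)) ^ 2) - (W + T) ^ 2 + U * V := by
    rw [hH, hE, hF, hT, hU, hV, Algebra.algebraMap_eq_smul_one]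
    simp only [pow_two, mul_sub, sub_mul, mul_add, add_mul, mul_neg, neg_mul, mul_smul_comm,
      smul_mul_assoc, smul_add, smul_sub, smul_neg, smul_smul, Complex.I_mul_I, mul_one, one_mul,
      hWO3] at hA12 hcas ⊢
    linear_combination (norm := module) Complex.I • hA12 - (1 : ℂ) • hcas
  have hFE : F * E = -((H + algebraMap ℂ B (1 / 2)) ^ 2) - (W - T) ^ 2 + V * U := by
    rw [hH, hE, hF, hT, hU, hV, Algebra.algebraMap_eq_smul_one]
    simp only [pow_two, mul_sub, sub_mul, mul_add, add_mul, mul_neg, neg_mul, mul_smul_comm,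
      smul_mul_assoc, smul_add, smul_sub, smul_neg, smul_smul, Complex.I_mul_I, mul_one, one_mul,
      hWO3] at hA12 hcas ⊢
    linear_combination (norm := module) (-Complex.I) • hA12 - (1 : ℂ) • hcas
  have hY : ∀ {Z Q : B}, Z * H = H * Z → H * Q = -(Q * H) →
      H * ((2 : ℂ) • (Z * Q)) = -((2 : ℂ) • (Z * Q) * H) := by
    intro Z Q hZ hQ
    rw [mul_smul_comm, smul_mul_assoc, ← mul_assoc, ← hZ, mul_assoc, hQ, mul_neg, smul_neg,
      mul_assoc]
  have hplus : (W + T) * H = H * (W + T) := by rw [add_mul, mul_add, hWH, hTH]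
  have hminus : (W - T) * H = H * (W - T) := by rw [sub_mul, mul_sub, hWH, hTH]
  -- The substitution `H ↦ -H`, `E ↔ F`, `T ↦ -T`, `U ↦ -V`, `V ↦ -U` preserves all the relations.
  have hHF' : -H * F - F * -H = F + (2 : ℂ) • ((W - T) * -V) := by
    linear_combination (norm := (simp only [neg_mul, mul_neg]; module)) (-1 : ℂ) • hHF
  have hHE' : -H * E - E * -H = -E + (2 : ℂ) • ((W + T) * -U) := by
    linear_combination (norm := (simp only [neg_mul, mul_neg]; module)) (-1 : ℂ) • hHE
  refine ⟨ladder_commutator hHE (hY hplus hHU), ?_,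
    ladder_mul_ladder hHE hHF hEF hpm hWH hWE hWU hTH hTE hTU hHU hHV, ?_⟩
  · have h := ladder_commutator hHF' (by
      have := hY hminus hHV
      simp only [mul_neg, neg_mul, smul_neg, neg_neg] at this ⊢
      exact this)
    linear_combination (norm := (simp only [neg_mul, mul_neg, smul_add, smul_neg, mul_add, add_mul,
      mul_smul_comm, smul_mul_assoc]; module)) h
  · have hsq : (-H - algebraMap ℂ B (1 / 2)) ^ 2 = (H + algebraMap ℂ B (1 / 2)) ^ 2 := by
      rw [← neg_add', neg_sq]
    have h := ladder_mul_ladder (H := -H) (E := F) (F := E) (W := W) (T := -T) (U := -V) (V := -U)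
      (by rw [← sub_eq_add_neg]; exact hHF') (by rw [sub_neg_eq_add]; exact hHE')
      (by rw [hFE, hsq, ← sub_eq_add_neg, neg_mul_neg])
      (by rw [neg_mul, hmp, neg_neg, mul_neg, neg_neg])
      (by rw [mul_neg, neg_mul, hWH]) hWF (by rw [mul_neg, neg_mul, hWV])
      (by rw [neg_mul_neg, neg_mul_neg, hTH]) (by rw [neg_mul, mul_neg, hTF])
      (by rw [neg_mul_neg, neg_mul_neg, hTV]) (by rw [neg_mul_neg, neg_mul_neg, hHV])
      (by rw [neg_mul_neg, neg_mul_neg, hHU])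
    rw [hsq, ← sub_eq_add_neg, neg_mul_neg] at h
    simp only [neg_mul, mul_neg, ← neg_add] at h
    rw [← h]
    simp only [smul_neg, neg_mul_neg]

end Ladder

/-! ### Elements of a ring containing a Clifford algebra -/

section Clifford

variable {B : Type*} [Ring B]

/-- The defining relations of the generators of `Cl(3)`. -/
structure IsCliffordTriple (e₁ e₂ e₃ : B) : Prop where
  sq₁ : e₁ * e₁ = 1
  sq₂ : e₂ * e₂ = 1
  sq₃ : e₃ * e₃ = 1
  mul₂₁ : e₂ * e₁ = -(e₁ * e₂)
  mul₃₁ : e₃ * e₁ = -(e₁ * e₃)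
  mul₃₂ : e₃ * e₂ = -(e₂ * e₃)

/-- The element `a` commutes with three given generators. -/
structure CommutesWith (e₁ e₂ e₃ a : B) : Prop where
  comm₁ : a * e₁ = e₁ * a
  comm₂ : a * e₂ = e₂ * a
  comm₃ : a * e₃ = e₃ * a

variable {e₁ e₂ e₃ c m₁ m₂ m₃ : B}

theorem IsCliffordTriple.rotate (h : IsCliffordTriple e₁ e₂ e₃) : IsCliffordTriple e₂ e₃ e₁ where
  sq₁ := h.sq₂
  sq₂ := h.sq₃
  sq₃ := h.sq₁
  mul₂₁ := h.mul₃₂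
  mul₃₁ := by rw [h.mul₂₁, neg_neg]
  mul₃₂ := by rw [h.mul₃₁, neg_neg]

theorem CommutesWith.rotate (h : CommutesWith e₁ e₂ e₃ c) : CommutesWith e₂ e₃ e₁ c :=
  ⟨h.comm₂, h.comm₃, h.comm₁⟩

theorem CommutesWith.add (hc : CommutesWith e₁ e₂ e₃ c) (hm : CommutesWith e₁ e₂ e₃ m₁) :
    CommutesWith e₁ e₂ e₃ (c + m₁) where
  comm₁ := by rw [add_mul, mul_add, hc.comm₁, hm.comm₁]
  comm₂ := by rw [add_mul, mul_add, hc.comm₂, hm.comm₂]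
  comm₃ := by rw [add_mul, mul_add, hc.comm₃, hm.comm₃]

theorem CommutesWith.one : CommutesWith e₁ e₂ e₃ 1 := by
  constructor <;> rw [one_mul, mul_one]

theorem CommutesWith.sum {ι : Type*} [Fintype ι] {c : ι → B}
    (hc : ∀ n, CommutesWith e₁ e₂ e₃ (c n)) :
    CommutesWith e₁ e₂ e₃ (∑ n, c n) where
  comm₁ := by simp only [Finset.sum_mul, Finset.mul_sum, (hc _).comm₁]
  comm₂ := by simp only [Finset.sum_mul, Finset.mul_sum, (hc _).comm₂]
  comm₃ := by simp only [Finset.sum_mul, Finset.mul_sum, (hc _).comm₃]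

theorem CommutesWith.mul (hc : CommutesWith e₁ e₂ e₃ c) (hm : CommutesWith e₁ e₂ e₃ m₁) :
    CommutesWith e₁ e₂ e₃ (c * m₁) where
  comm₁ := by rw [mul_assoc, hm.comm₁, ← mul_assoc, hc.comm₁, mul_assoc]
  comm₂ := by rw [mul_assoc, hm.comm₂, ← mul_assoc, hc.comm₂, mul_assoc]
  comm₃ := by rw [mul_assoc, hm.comm₃, ← mul_assoc, hc.comm₃, mul_assoc]

theorem CommutesWith.sub (hc : CommutesWith e₁ e₂ e₃ c) (hm : CommutesWith e₁ e₂ e₃ m₁) :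
    CommutesWith e₁ e₂ e₃ (c - m₁) where
  comm₁ := by rw [sub_mul, mul_sub, hc.comm₁, hm.comm₁]
  comm₂ := by rw [sub_mul, mul_sub, hc.comm₂, hm.comm₂]
  comm₃ := by rw [sub_mul, mul_sub, hc.comm₃, hm.comm₃]

/-- Rewriting rules that bring words in the generators into lexicographic order. -/
theorem IsCliffordTriple.rules (h : IsCliffordTriple e₁ e₂ e₃) :
    (e₁ * e₁ = 1 ∧ e₂ * e₂ = 1 ∧ e₃ * e₃ = 1) ∧
    (e₂ * e₁ = -(e₁ * e₂) ∧ e₃ * e₁ = -(e₁ * e₃) ∧ e₃ * e₂ = -(e₂ * e₃)) ∧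
    (∀ z, e₁ * (e₁ * z) = z ∧ e₂ * (e₂ * z) = z ∧ e₃ * (e₃ * z) = z) ∧
    (∀ z, e₂ * (e₁ * z) = -(e₁ * (e₂ * z)) ∧ e₃ * (e₁ * z) = -(e₁ * (e₃ * z)) ∧
      e₃ * (e₂ * z) = -(e₂ * (e₃ * z))) := by
  refine ⟨⟨h.sq₁, h.sq₂, h.sq₃⟩, ⟨h.mul₂₁, h.mul₃₁, h.mul₃₂⟩, fun z => ⟨?_, ?_, ?_⟩,
    fun z => ⟨?_, ?_, ?_⟩⟩ <;>
  simp only [← mul_assoc, h.sq₁, h.sq₂, h.sq₃, h.mul₂₁, h.mul₃₁, h.mul₃₂, one_mul, neg_mul]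

/-- Rewriting rules that move the generators to the left of an element commuting with them. -/
theorem CommutesWith.rules (h : CommutesWith e₁ e₂ e₃ c) :
    (c * e₁ = e₁ * c ∧ c * e₂ = e₂ * c ∧ c * e₃ = e₃ * c) ∧
    (∀ z, c * (e₁ * z) = e₁ * (c * z) ∧ c * (e₂ * z) = e₂ * (c * z) ∧
      c * (e₃ * z) = e₃ * (c * z)) := by
  refine ⟨⟨h.comm₁, h.comm₂, h.comm₃⟩, fun z => ⟨?_, ?_, ?_⟩⟩ <;>
  simp only [← mul_assoc, h.comm₁, h.comm₂, h.comm₃]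

/-- The pseudoscalar `e₁e₂e₃` is central in `Cl(3)`. -/
theorem IsCliffordTriple.pseudoscalar (h : IsCliffordTriple e₁ e₂ e₃) :
    CommutesWith e₁ e₂ e₃ (e₁ * e₂ * e₃) := by
  constructor <;>
  simp only [mul_assoc, mul_neg, neg_neg, mul_one, h.rules]

theorem IsCliffordTriple.pseudoscalar_rotate (h : IsCliffordTriple e₁ e₂ e₃) :
    e₂ * e₃ * e₁ = e₁ * e₂ * e₃ := by
  rw [mul_assoc, h.mul₃₁, mul_neg, ← mul_assoc, h.mul₂₁, neg_mul, neg_neg]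

theorem IsCliffordTriple.pseudoscalar_mul_self (h : IsCliffordTriple e₁ e₂ e₃) :
    e₁ * e₂ * e₃ * (e₁ * e₂ * e₃) = -1 := by
  simp only [mul_assoc, mul_neg, neg_neg, mul_one, h.rules]

/-- The Clifford-valued element `c - e₂e₃ m₁ - e₃e₁ m₂ - e₁e₂ m₃`. -/
def spinElement (e₁ e₂ e₃ c m₁ m₂ m₃ : B) : B :=
  c - e₂ * e₃ * m₁ - e₃ * e₁ * m₂ - e₁ * e₂ * m₃

theorem spinElement_rotate : spinElement e₂ e₃ e₁ c m₂ m₃ m₁ = spinElement e₁ e₂ e₃ c m₁ m₂ m₃ := by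
  unfold spinElement
  abel

/-- The anticommutator of the spin element with `e₃`. -/
theorem spinElement_anticomm
    (h : IsCliffordTriple e₁ e₂ e₃) (hc : CommutesWith e₁ e₂ e₃ c)
    (h₁ : CommutesWith e₁ e₂ e₃ m₁) (h₂ : CommutesWith e₁ e₂ e₃ m₂)
    (h₃ : CommutesWith e₁ e₂ e₃ m₃) :
    spinElement e₁ e₂ e₃ c m₁ m₂ m₃ * e₃ + e₃ * spinElement e₁ e₂ e₃ c m₁ m₂ m₃ =
      2 * (e₃ * c - e₁ * e₂ * e₃ * m₃) := by
  simp only [spinElement, mul_sub, sub_mul, mul_assoc, mul_neg, neg_mul,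
    h.rules, hc.rules, h₁.rules, h₂.rules, h₃.rules]
  noncomm_ring

/-- The relations between the `mᵢ` say exactly that the square of the spin element is free of
Clifford elements. -/
theorem spinElement_mul_self
    (h : IsCliffordTriple e₁ e₂ e₃) (hc : CommutesWith e₁ e₂ e₃ c)
    (h₁ : CommutesWith e₁ e₂ e₃ m₁) (h₂ : CommutesWith e₁ e₂ e₃ m₂)
    (h₃ : CommutesWith e₁ e₂ e₃ m₃)
    (h₁₂ : m₁ * m₂ - m₂ * m₁ = -(c * m₃ + m₃ * c))
    (h₂₃ : m₂ * m₃ - m₃ * m₂ = -(c * m₁ + m₁ * c))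
    (h₃₁ : m₃ * m₁ - m₁ * m₃ = -(c * m₂ + m₂ * c)) :
    spinElement e₁ e₂ e₃ c m₁ m₂ m₃ * spinElement e₁ e₂ e₃ c m₁ m₂ m₃ =
      c * c - m₁ * m₁ - m₂ * m₂ - m₃ * m₃ := by
  simp only [spinElement, mul_sub, sub_mul, mul_assoc, mul_neg, neg_mul,
    h.rules, hc.rules, h₁.rules, h₂.rules, h₃.rules]
  linear_combination (norm := noncomm_ring) (-(e₁ * e₂)) * h₁₂ - e₂ * e₃ * h₂₃ + e₁ * e₃ * h₃₁

/-- The commutator of two half anticommutators `½{P, eᵢ}` of the spin element `P`. -/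
theorem anticomm_commutator
    (h : IsCliffordTriple e₁ e₂ e₃) (hc : CommutesWith e₁ e₂ e₃ c)
    (h₁ : CommutesWith e₁ e₂ e₃ m₁) (h₂ : CommutesWith e₁ e₂ e₃ m₂)
    (h₃ : CommutesWith e₁ e₂ e₃ m₃)
    (h₁₂ : m₁ * m₂ - m₂ * m₁ = -(c * m₃ + m₃ * c)) :
    (e₁ * c - e₁ * e₂ * e₃ * m₁) * (e₂ * c - e₁ * e₂ * e₃ * m₂) -
        (e₂ * c - e₁ * e₂ * e₃ * m₂) * (e₁ * c - e₁ * e₂ * e₃ * m₁) =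
      spinElement e₁ e₂ e₃ c m₁ m₂ m₃ * (e₁ * e₂ * c) +
        e₁ * e₂ * c * spinElement e₁ e₂ e₃ c m₁ m₂ m₃ := by
  simp only [spinElement, mul_sub, sub_mul, mul_assoc, mul_neg, neg_mul,
    h.rules, hc.rules, h₁.rules, h₂.rules, h₃.rules]
  linear_combination (norm := noncomm_ring) (-1 : B) * h₁₂

/-- The sum of the squares of the half anticommutators `½{P, eᵢ}` is `P² + cP + Pc`,
with `P²` in the form given by `spinElement_mul_self`. -/
theorem sum_anticomm_mul_self
    (h : IsCliffordTriple e₁ e₂ e₃) (hc : CommutesWith e₁ e₂ e₃ c)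
    (h₁ : CommutesWith e₁ e₂ e₃ m₁) (h₂ : CommutesWith e₁ e₂ e₃ m₂)
    (h₃ : CommutesWith e₁ e₂ e₃ m₃) :
    (e₁ * c - e₁ * e₂ * e₃ * m₁) * (e₁ * c - e₁ * e₂ * e₃ * m₁) +
        (e₂ * c - e₁ * e₂ * e₃ * m₂) * (e₂ * c - e₁ * e₂ * e₃ * m₂) +
        (e₃ * c - e₁ * e₂ * e₃ * m₃) * (e₃ * c - e₁ * e₂ * e₃ * m₃) =
      c * c - m₁ * m₁ - m₂ * m₂ - m₃ * m₃ +
        (c * spinElement e₁ e₂ e₃ c m₁ m₂ m₃ + spinElement e₁ e₂ e₃ c m₁ m₂ m₃ * c) := by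
  simp only [spinElement, mul_sub, sub_mul, mul_assoc, mul_neg, neg_mul,
    h.rules, hc.rules, h₁.rules, h₂.rules, h₃.rules]
  noncomm_ring

end Clifford

/-! ### Angular momenta of Dunkl operators in dimension three -/

/-- The expansion of the commutator of two products of coordinates and commuting operators. -/
theorem angMom_comm_expand {B : Type*} [Ring B] {x₁ x₂ x₃ D₁ D₂ D₃ C₁₁ C₁₂ C₁₃ C₂₃ : B}
    (hx₁₂ : x₁ * x₂ = x₂ * x₁) (hx₁₃ : x₁ * x₃ = x₃ * x₁) (hx₂₃ : x₂ * x₃ = x₃ * x₂)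
    (hD₁₂ : D₁ * D₂ = D₂ * D₁) (hD₁₃ : D₁ * D₃ = D₃ * D₁) (hD₂₃ : D₂ * D₃ = D₃ * D₂)
    (h₁₁ : D₁ * x₁ = x₁ * D₁ + C₁₁) (h₁₂ : D₁ * x₂ = x₂ * D₁ + C₁₂)
    (h₁₃ : D₁ * x₃ = x₃ * D₁ + C₁₃) (h₂₁ : D₂ * x₁ = x₁ * D₂ + C₁₂)
    (h₂₃ : D₂ * x₃ = x₃ * D₂ + C₂₃) (h₃₁ : D₃ * x₁ = x₁ * D₃ + C₁₃)
    (h₃₂ : D₃ * x₂ = x₂ * D₃ + C₂₃) :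
    (x₃ * D₁ - x₁ * D₃) * (x₁ * D₂ - x₂ * D₁) - (x₁ * D₂ - x₂ * D₁) * (x₃ * D₁ - x₁ * D₃) =
      (x₃ * C₁₁ * D₂ - x₂ * C₁₁ * D₃) + (x₁ * C₁₂ * D₃ - x₃ * C₁₂ * D₁) +
        (x₂ * C₁₃ * D₁ - x₁ * C₁₃ * D₂) := by
  have key : ∀ a b c d C : B, b * c = c * b + C →
      a * b * (c * d) = a * c * (b * d) + a * C * d := by
    intro a b c d C h
    rw [mul_assoc, ← mul_assoc b, h]
    noncomm_ring
  simp only [mul_sub, sub_mul]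
  rw [key _ _ _ _ _ h₁₁, key _ _ _ _ _ h₁₂, key _ _ _ _ _ h₃₁, key _ _ _ _ _ h₃₂,
    key _ _ _ _ _ h₂₃, key _ _ _ _ _ h₂₁, key _ _ _ _ _ h₁₃, key _ _ _ _ _ h₁₁,
    hx₁₂, hx₁₃, hx₂₃, hD₁₂, hD₁₃, hD₂₃]
  abel

section Dunkl

variable {B : Type*} [Ring B] [Algebra ℂ B] {ι : Type*} [Fintype ι]

/-- The relations between the Clifford generators `e`, the coordinates `x`, the Dunkl operators
`D` and the reflections `σ` in the unit vectors `r`, with multiplicities `κ`. -/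
structure DunklRelations (e x D : Fin 3 → B) (r : ι → Fin 3 → ℂ) (κ : ι → ℂ) (σ : ι → B) :
    Prop where
  unit : ∀ n, r n 0 * r n 0 + r n 1 * r n 1 + r n 2 * r n 2 = 1
  clifford : IsCliffordTriple (e 0) (e 1) (e 2)
  comm_x : ∀ i, CommutesWith (e 0) (e 1) (e 2) (x i)
  comm_D : ∀ i, CommutesWith (e 0) (e 1) (e 2) (D i)
  comm_σ : ∀ n, CommutesWith (e 0) (e 1) (e 2) (σ n)
  x_x : ∀ i j, x i * x j = x j * x i
  D_D : ∀ i j, D i * D j = D j * D i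
  D_x : ∀ i j, D i * x j = x j * D i + ((if i = j then 1 else 0) +
    ∑ n, (2 * κ n * r n i * r n j) • σ n)
  σ_x : ∀ n i, σ n * x i = (x i - (2 * r n i) • (r n 0 • x 0 + r n 1 • x 1 + r n 2 • x 2)) * σ n
  σ_D : ∀ n i, σ n * D i = (D i - (2 * r n i) • (r n 0 • D 0 + r n 1 • D 1 + r n 2 • D 2)) * σ n

/-- The relations are preserved by a cyclic permutation of the coordinates. -/
theorem DunklRelations.rotate {e x D : Fin 3 → B} {r : ι → Fin 3 → ℂ} {κ : ι → ℂ} {σ : ι → B}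
    (h : DunklRelations e x D r κ σ) :
    DunklRelations (fun i => e (i + 1)) (fun i => x (i + 1)) (fun i => D (i + 1))
      (fun n i => r n (i + 1)) κ σ where
  unit n := by
    have := h.unit n
    change r n 1 * r n 1 + r n 2 * r n 2 + r n 0 * r n 0 = 1
    linear_combination this
  clifford := h.clifford.rotate
  comm_x i := (h.comm_x _).rotate
  comm_D i := (h.comm_D _).rotate
  comm_σ n := (h.comm_σ n).rotate
  x_x i j := h.x_x _ _
  D_D i j := h.D_D _ _
  D_x i j := by
    have := h.D_x (i + 1) (j + 1)
    simpa only [add_left_inj] using this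
  σ_x n i := by
    have := h.σ_x n (i + 1)
    change σ n * x (i + 1) =
      (x (i + 1) - (2 * r n (i + 1)) • (r n 1 • x 1 + r n 2 • x 2 + r n 0 • x 0)) * σ n
    rw [this, ← add_rotate (r n 0 • x 0)]
  σ_D n i := by
    have := h.σ_D n (i + 1)
    change σ n * D (i + 1) =
      (D (i + 1) - (2 * r n (i + 1)) • (r n 1 • D 1 + r n 2 • D 2 + r n 0 • D 0)) * σ n
    rw [this, ← add_rotate (r n 0 • D 0)]

/-- The Dunkl angular momentum around the axis `i`. -/
def angMom (x D : Fin 3 → B) (i : Fin 3) : B := x (i + 1) * D (i + 2) - x (i + 2) * D (i + 1)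

/-- The element `½ + ∑ κ(r) σ_r`. -/
def shift (κ : ι → ℂ) (σ : ι → B) : B := (1 / 2 : ℂ) • 1 + ∑ n, κ n • σ n

variable {e x D : Fin 3 → B} {r : ι → Fin 3 → ℂ} {κ : ι → ℂ} {σ : ι → B}

/-- The contribution of one reflection to the commutator of two angular momenta. -/
theorem DunklRelations.reflection_term (h : DunklRelations e x D r κ σ) (n : ι) :
    r n 0 • (x 2 * σ n * D 1 - x 1 * σ n * D 2) + r n 1 • (x 0 * σ n * D 2 - x 2 * σ n * D 0) +
        r n 2 • (x 1 * σ n * D 0 - x 0 * σ n * D 1) =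
      -(r n 0 • (angMom x D 0 * σ n) + r n 1 • (angMom x D 1 * σ n) +
        r n 2 • (angMom x D 2 * σ n)) := by
  change _ = -(r n 0 • ((x 1 * D 2 - x 2 * D 1) * σ n) + r n 1 • ((x 2 * D 0 - x 0 * D 2) * σ n) +
        r n 2 • ((x 0 * D 1 - x 1 * D 0) * σ n))
  simp only [mul_assoc, h.σ_D, mul_add, add_mul, mul_sub, sub_mul, smul_mul_assoc, mul_smul_comm]
  module

/-- A reflection acts on the angular momenta as on an axial vector, that is, by minus the
reflection; the determinant of the reflection accounts for the anticommutator. -/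
theorem DunklRelations.reflection_anticomm (h : DunklRelations e x D r κ σ) (n : ι) :
    σ n * angMom x D 0 + angMom x D 0 * σ n =
      (2 * r n 0) • (r n 0 • (angMom x D 0 * σ n) + r n 1 • (angMom x D 1 * σ n) +
        r n 2 • (angMom x D 2 * σ n)) := by
  change σ n * (x 1 * D 2 - x 2 * D 1) + (x 1 * D 2 - x 2 * D 1) * σ n =
    (2 * r n 0) • (r n 0 • ((x 1 * D 2 - x 2 * D 1) * σ n) +
      r n 1 • ((x 2 * D 0 - x 0 * D 2) * σ n) + r n 2 • ((x 0 * D 1 - x 1 * D 0) * σ n))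
  have hx : ∀ i z, σ n * (x i * z) =
      (x i - (2 * r n i) • (r n 0 • x 0 + r n 1 • x 1 + r n 2 • x 2)) * (σ n * z) := by
    intro i z
    rw [← mul_assoc, h.σ_x, mul_assoc]
  simp only [mul_assoc, hx, h.σ_D, mul_add, add_mul, mul_sub, sub_mul, smul_mul_assoc,
    mul_smul_comm, smul_add, smul_sub, smul_smul]
  linear_combination (norm := module)
    (-2 * h.unit n) • (x 1 * (D 2 * σ n) - x 2 * (D 1 * σ n))

/-- The Dunkl angular momenta satisfy the relations of `so(3)` with the scalar `-1` replaced by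
`-2 (½ + ∑ κ(r) σ_r)`, suitably symmetrised. -/
theorem DunklRelations.angMom_comm (h : DunklRelations e x D r κ σ) :
    angMom x D 1 * angMom x D 2 - angMom x D 2 * angMom x D 1 =
      -(shift κ σ * angMom x D 0 + angMom x D 0 * shift κ σ) := by
  have hC : ∀ i j : Fin 3, ((if i = j then 1 else 0) + ∑ n, (2 * κ n * r n i * r n j) • σ n) =
      ((if j = i then 1 else 0) + ∑ n, (2 * κ n * r n j * r n i) • σ n) := by
    intro i j
    simp only [eq_comm (a := i), mul_right_comm _ (r _ i)]
  have h21 := h.D_x 1 0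
  have h31 := h.D_x 2 0
  have h32 := h.D_x 2 1
  rw [hC] at h21 h31 h32
  have key := angMom_comm_expand (h.x_x 0 1) (h.x_x 0 2) (h.x_x 1 2) (h.D_D 0 1) (h.D_D 0 2)
    (h.D_D 1 2) (h.D_x 0 0) (h.D_x 0 1) (h.D_x 0 2) h21 (h.D_x 1 2) h31 h32
  change (x 2 * D 0 - x 0 * D 2) * (x 0 * D 1 - x 1 * D 0) -
    (x 0 * D 1 - x 1 * D 0) * (x 2 * D 0 - x 0 * D 2) = _
  rw [key]
  have h01 : (0 : Fin 3) ≠ 1 := by decide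
  have h02 : (0 : Fin 3) ≠ 2 := by decide
  rw [if_pos rfl, if_neg h01, if_neg h02]
  have hsum : ∀ n, (2 * κ n * r n 0) • (r n 0 • (x 2 * σ n * D 1 - x 1 * σ n * D 2) +
      r n 1 • (x 0 * σ n * D 2 - x 2 * σ n * D 0) + r n 2 • (x 1 * σ n * D 0 - x 0 * σ n * D 1)) =
      -(κ n • (σ n * angMom x D 0 + angMom x D 0 * σ n)) := by
    intro n
    rw [h.reflection_term, h.reflection_anticomm]
    module
  have hsum' := Finset.sum_congr (rfl : Finset.univ = Finset.univ) fun n _ => hsum n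
  rw [shift]
  simp only [mul_add, add_mul, Finset.mul_sum, Finset.sum_mul, smul_mul_assoc, mul_smul_comm,
    one_mul, mul_one, zero_add, smul_add, smul_sub, Finset.sum_add_distrib,
    Finset.sum_sub_distrib, smul_smul, Finset.sum_neg_distrib] at hsum' ⊢
  have hm : angMom x D 0 = x 1 * D 2 - x 2 * D 1 := rfl
  linear_combination (norm := module) hsum' + hm

end Dunkl

/-! ### The spin element and the double covering of the reflection group -/

section Spin

variable {B : Type*} [Ring B] [Algebra ℂ B] {ι : Type*} [Fintype ι]

theorem CommutesWith.smul {e₁ e₂ e₃ c : B} (hc : CommutesWith e₁ e₂ e₃ c) (a : ℂ) :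
    CommutesWith e₁ e₂ e₃ (a • c) where
  comm₁ := by rw [smul_mul_assoc, mul_smul_comm, hc.comm₁]
  comm₂ := by rw [smul_mul_assoc, mul_smul_comm, hc.comm₂]
  comm₃ := by rw [smul_mul_assoc, mul_smul_comm, hc.comm₃]

/-- The element `∑ eᵢ yᵢ`. -/
def cliffordSum (e y : Fin 3 → B) : B := e 0 * y 0 + e 1 * y 1 + e 2 * y 2

/-- The Clifford vector of `r`. -/
def cliffordVec (e : Fin 3 → B) (r : Fin 3 → ℂ) : B := r 0 • e 0 + r 1 • e 1 + r 2 • e 2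

/-- The one-index symmetry `∑ κ(r) rᵢ σ̃_r`, with `σ̃_r` the product of the Clifford vector of `r`
and `σ_r`. -/
def oneSym (e : Fin 3 → B) (r : ι → Fin 3 → ℂ) (κ : ι → ℂ) (σ : ι → B) (i : Fin 3) : B :=
  ∑ n, (κ n * r n i) • (cliffordVec e (r n) * σ n)

/-- The spin element `½ + ∑ κ(r) σ_r - e₂e₃M₁ - e₃e₁M₂ - e₁e₂M₃`, where the `Mᵢ` are the angular
momenta. It differs by the scalar `½` from `½([D, x] - 1)`, with `D` the Dunkl–Dirac operator and
`x` the vector variable. -/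
def spin (e x D : Fin 3 → B) (κ : ι → ℂ) (σ : ι → B) : B :=
  spinElement (e 0) (e 1) (e 2) (shift κ σ) (angMom x D 0) (angMom x D 1) (angMom x D 2)

variable {e x D : Fin 3 → B} {r : ι → Fin 3 → ℂ} {κ : ι → ℂ} {σ : ι → B}

theorem oneSym_rotate (i : Fin 3) :
    oneSym (fun i => e (i + 1)) (fun n i => r n (i + 1)) κ σ i = oneSym e r κ σ (i + 1) := by
  unfold oneSym cliffordVec
  refine Finset.sum_congr rfl fun n _ => ?_
  change (κ n * r n (i + 1)) • ((r n 1 • e 1 + r n 2 • e 2 + r n 0 • e 0) * σ n) = _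
  rw [← add_rotate (r n 0 • e 0)]

theorem spin_rotate :
    spin (fun i => e (i + 1)) (fun i => x (i + 1)) (fun i => D (i + 1)) κ σ = spin e x D κ σ :=
  spinElement_rotate

namespace DunklRelations

theorem comm_angMom (h : DunklRelations e x D r κ σ) (i : Fin 3) :
    CommutesWith (e 0) (e 1) (e 2) (angMom x D i) :=
  ((h.comm_x _).mul (h.comm_D _)).sub ((h.comm_x _).mul (h.comm_D _))

theorem comm_shift (h : DunklRelations e x D r κ σ) :
    CommutesWith (e 0) (e 1) (e 2) (shift κ σ) :=
  (CommutesWith.one.smul _).add (CommutesWith.sum fun n => (h.comm_σ n).smul _)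

theorem cliffordVec_mul_self (h : DunklRelations e x D r κ σ) (n : ι) :
    cliffordVec e (r n) * cliffordVec e (r n) = 1 := by
  simp only [cliffordVec, mul_add, add_mul, smul_mul_assoc, mul_smul_comm, h.clifford.rules]
  linear_combination (norm := module) (h.unit n) • (1 : B)

theorem cliffordVec_anticomm (h : DunklRelations e x D r κ σ) (n : ι) (i : Fin 3) :
    cliffordVec e (r n) * e i + e i * cliffordVec e (r n) = (2 * r n i) • 1 := by
  fin_cases i <;>
  · simp only [cliffordVec, mul_add, add_mul, smul_mul_assoc, mul_smul_comm, Fin.zero_eta,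
      Fin.mk_one, Fin.reduceFinMk, h.clifford.rules]
    module

/-- The elements `σ̃_r` anticommute with the Dunkl–Dirac operator and with the vector variable. -/
theorem tilde_mul_cliffordSum (h : DunklRelations e x D r κ σ) {y : Fin 3 → B}
    (hy : ∀ i, CommutesWith (e 0) (e 1) (e 2) (y i)) (n : ι)
    (hσ : ∀ i, σ n * y i =
      (y i - (2 * r n i) • (r n 0 • y 0 + r n 1 • y 1 + r n 2 • y 2)) * σ n) :
    cliffordVec e (r n) * σ n * cliffordSum e y =
      -(cliffordSum e y * (cliffordVec e (r n) * σ n)) := by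
  obtain ⟨w, hw⟩ : ∃ w, w = r n 0 • y 0 + r n 1 • y 1 + r n 2 • y 2 := ⟨_, rfl⟩
  have h1 : σ n * cliffordSum e y =
      (cliffordSum e y - (2 : ℂ) • (cliffordVec e (r n) * w)) * σ n := by
    simp only [← hw] at hσ
    simp only [cliffordSum, cliffordVec, mul_add, ← mul_assoc, (h.comm_σ n).comm₁,
      (h.comm_σ n).comm₂, (h.comm_σ n).comm₃]
    simp only [mul_assoc, hσ, add_mul, mul_sub, sub_mul, smul_mul_assoc, mul_smul_comm]
    module
  have h2 : cliffordVec e (r n) * cliffordSum e y + cliffordSum e y * cliffordVec e (r n) =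
      (2 : ℂ) • w := by
    rw [hw]
    simp only [cliffordVec, cliffordSum, mul_add, add_mul, smul_mul_assoc, mul_smul_comm,
      mul_assoc, h.clifford.rules, (hy _).rules]
    module
  have h3 : cliffordVec e (r n) * (cliffordVec e (r n) * w) = w := by
    rw [← mul_assoc, h.cliffordVec_mul_self, one_mul]
  rw [mul_assoc, h1, ← mul_assoc, ← mul_assoc, ← neg_mul]
  congr 1
  rw [mul_sub, mul_smul_comm, h3]
  linear_combination (norm := module) h2

theorem tilde_mul_e (h : DunklRelations e x D r κ σ) (n : ι) (i : Fin 3) :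
    cliffordVec e (r n) * σ n * e i =
      -(e i * (cliffordVec e (r n) * σ n)) + (2 * r n i) • σ n := by
  have h1 : σ n * e i = e i * σ n := by
    fin_cases i
    exacts [(h.comm_σ n).comm₁, (h.comm_σ n).comm₂, (h.comm_σ n).comm₃]
  have h2 := congrArg (· * σ n) (h.cliffordVec_anticomm n i)
  simp only [add_mul, smul_mul_assoc, one_mul, mul_assoc] at h2
  rw [mul_assoc, h1, ← h2]
  abel

/-- The commutator of the Dunkl–Dirac operator with the vector variable. -/
theorem cliffordSum_commutator (h : DunklRelations e x D r κ σ) :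
    cliffordSum e D * cliffordSum e x - cliffordSum e x * cliffordSum e D =
      (2 : ℂ) • spin e x D κ σ + (2 : ℂ) • 1 := by
  have hD : ∀ i j, D i * x j = x j * D i + (D i * x j - x j * D i) := fun i j => by abel
  have hsymm : ∀ i j, D i * x j - x j * D i = D j * x i - x i * D j := by
    intro i j
    rw [h.D_x, h.D_x, add_sub_cancel_left, add_sub_cancel_left]
    simp only [eq_comm (a := i), mul_right_comm _ (r _ i)]
  have h01 := hsymm 0 1
  have h02 := hsymm 0 2
  have h12 := hsymm 1 2
  have htr : (D 0 * x 0 - x 0 * D 0) + (D 1 * x 1 - x 1 * D 1) + (D 2 * x 2 - x 2 * D 2) =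
      (2 : ℂ) • 1 + (2 : ℂ) • shift κ σ := by
    rw [h.D_x, h.D_x, h.D_x, add_sub_cancel_left, add_sub_cancel_left, add_sub_cancel_left,
      if_pos rfl, if_pos rfl, if_pos rfl, shift]
    have : ∑ n, (2 * κ n * r n 0 * r n 0) • σ n + ∑ n, (2 * κ n * r n 1 * r n 1) • σ n +
        ∑ n, (2 * κ n * r n 2 * r n 2) • σ n = (2 : ℂ) • ∑ n, κ n • σ n := by
      rw [← Finset.sum_add_distrib, ← Finset.sum_add_distrib, Finset.smul_sum]
      refine Finset.sum_congr rfl fun n _ => ?_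
      linear_combination (norm := module) (2 * κ n * h.unit n) • σ n
    linear_combination (norm := module) this
  have hspin : spin e x D κ σ = shift κ σ - e 1 * e 2 * (x 1 * D 2 - x 2 * D 1) -
      e 2 * e 0 * (x 2 * D 0 - x 0 * D 2) - e 0 * e 1 * (x 0 * D 1 - x 1 * D 0) := rfl
  rw [hspin]
  have h01' := congrArg (e 0 * e 1 * ·) h01
  have h02' := congrArg (e 0 * e 2 * ·) h02
  have h12' := congrArg (e 1 * e 2 * ·) h12
  simp only [cliffordSum, mul_add, add_mul, mul_sub,
      mul_assoc, neg_mul, h.clifford.rules, (h.comm_x _).rules, (h.comm_D _).rules]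
      at h01' h02' h12' ⊢
  linear_combination (norm := module) htr + h01' + h02' + h12'

/-- The elements `σ̃_r` commute with the spin element, which is up to a scalar half of the
commutator of two elements anticommuting with `σ̃_r`. -/
theorem tilde_comm_spin (h : DunklRelations e x D r κ σ) (n : ι) :
    cliffordVec e (r n) * σ n * spin e x D κ σ = spin e x D κ σ * (cliffordVec e (r n) * σ n) := by
  have hD := h.tilde_mul_cliffordSum h.comm_D n (h.σ_D n)
  have hx := h.tilde_mul_cliffordSum h.comm_x n (h.σ_x n)
  obtain ⟨s, hs⟩ : ∃ s, s = cliffordVec e (r n) * σ n := ⟨_, rfl⟩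
  rw [← hs] at hD hx ⊢
  have hDx : s * (cliffordSum e D * cliffordSum e x) = cliffordSum e D * cliffordSum e x * s := by
    rw [← mul_assoc, hD, neg_mul, mul_assoc, hx, mul_neg, neg_neg, mul_assoc]
  have hxD : s * (cliffordSum e x * cliffordSum e D) = cliffordSum e x * cliffordSum e D * s := by
    rw [← mul_assoc, hx, neg_mul, mul_assoc, hD, mul_neg, neg_neg, mul_assoc]
  have hspin : spin e x D κ σ =
      (1 / 2 : ℂ) • (cliffordSum e D * cliffordSum e x - cliffordSum e x * cliffordSum e D) -
        1 := by
    rw [h.cliffordSum_commutator]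
    module
  rw [hspin]
  simp only [mul_sub, sub_mul, mul_smul_comm, smul_mul_assoc, hDx, hxD, mul_one, one_mul]

theorem oneSym_comm_spin (h : DunklRelations e x D r κ σ) (i : Fin 3) :
    oneSym e r κ σ i * spin e x D κ σ = spin e x D κ σ * oneSym e r κ σ i := by
  simp only [oneSym, Finset.sum_mul, Finset.mul_sum, smul_mul_assoc, mul_smul_comm,
    h.tilde_comm_spin]

/-- The one-index symmetries are half of `[D, xᵢ] - eᵢ`. -/
theorem oneSym_eq (h : DunklRelations e x D r κ σ) (i : Fin 3) :
    (1 / 2 : ℂ) • (cliffordSum e D * x i - x i * cliffordSum e D - e i) = oneSym e r κ σ i := by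
  have h1 : cliffordSum e D * x i - x i * cliffordSum e D =
      e i + ∑ n, (2 * (κ n * r n i)) • (cliffordVec e (r n) * σ n) := by
    simp only [cliffordSum, mul_add, add_mul, ← mul_assoc, (h.comm_x i).comm₁,
      (h.comm_x i).comm₂, (h.comm_x i).comm₃]
    simp only [mul_assoc, h.D_x, mul_add, Finset.mul_sum, mul_smul_comm]
    have h2 : e 0 * (if 0 = i then 1 else 0) + e 1 * (if 1 = i then 1 else 0) +
        e 2 * (if 2 = i then 1 else 0) = e i := by
      fin_cases i <;> simp
    have h3 : ∑ n, (2 * (κ n * r n i)) • (cliffordVec e (r n) * σ n) =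
        ∑ n, (2 * (κ n * (r n 0 * r n i))) • (e 0 * σ n) +
        ∑ n, (2 * (κ n * (r n 1 * r n i))) • (e 1 * σ n) +
        ∑ n, (2 * (κ n * (r n 2 * r n i))) • (e 2 * σ n) := by
      rw [← Finset.sum_add_distrib, ← Finset.sum_add_distrib]
      refine Finset.sum_congr rfl fun n _ => ?_
      simp only [cliffordVec, add_mul, smul_mul_assoc]
      module
    rw [h3]
    linear_combination (norm := module) h2
  rw [h1, add_sub_cancel_left, oneSym, Finset.smul_sum]
  refine Finset.sum_congr rfl fun n _ => ?_
  module

theorem e_anticomm_oneSym (h : DunklRelations e x D r κ σ) (i j : Fin 3) :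
    e i * oneSym e r κ σ j + oneSym e r κ σ j * e i = ∑ n, (2 * κ n * r n i * r n j) • σ n := by
  simp only [oneSym, Finset.sum_mul, Finset.mul_sum, ← Finset.sum_add_distrib, smul_mul_assoc,
    mul_smul_comm, h.tilde_mul_e]
  refine Finset.sum_congr rfl fun n _ => ?_
  module

theorem sum_e_anticomm_oneSym (h : DunklRelations e x D r κ σ) :
    (e 0 * oneSym e r κ σ 0 + oneSym e r κ σ 0 * e 0) +
      (e 1 * oneSym e r κ σ 1 + oneSym e r κ σ 1 * e 1) +
      (e 2 * oneSym e r κ σ 2 + oneSym e r κ σ 2 * e 2) =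
      (2 : ℂ) • shift κ σ - 1 := by
  simp only [h.e_anticomm_oneSym, shift, ← Finset.sum_add_distrib]
  have : ∑ n, ((2 * κ n * r n 0 * r n 0) • σ n + (2 * κ n * r n 1 * r n 1) • σ n +
      (2 * κ n * r n 2 * r n 2) • σ n) = (2 : ℂ) • ∑ n, κ n • σ n := by
    rw [Finset.smul_sum]
    refine Finset.sum_congr rfl fun n _ => ?_
    linear_combination (norm := module) (2 * κ n * h.unit n) • σ n
  rw [this]
  module

theorem e_cross_oneSym (h : DunklRelations e x D r κ σ) :
    e 0 * oneSym e r κ σ 1 - e 1 * oneSym e r κ σ 0 =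
      e 0 * e 1 * (shift κ σ - (1 / 2 : ℂ) • 1) - e 0 * e 1 * e 2 * oneSym e r κ σ 2 := by
  rw [shift, add_sub_cancel_left]
  simp only [oneSym, Finset.mul_sum, ← Finset.sum_sub_distrib, mul_smul_comm]
  refine Finset.sum_congr rfl fun n _ => ?_
  simp only [cliffordVec, mul_add, add_mul, smul_mul_assoc, mul_smul_comm,
      mul_assoc, mul_neg, h.clifford.rules]
  linear_combination (norm := module) (κ n * h.unit n) • (e 0 * (e 1 * σ n))

theorem oneSym_cross_e (h : DunklRelations e x D r κ σ) :
    oneSym e r κ σ 0 * e 1 - oneSym e r κ σ 1 * e 0 =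
      e 0 * e 1 * (shift κ σ - (1 / 2 : ℂ) • 1) - e 0 * e 1 * e 2 * oneSym e r κ σ 2 := by
  rw [← h.e_cross_oneSym]
  have h1 := h.e_anticomm_oneSym 0 1
  have h2 := h.e_anticomm_oneSym 1 0
  simp only [mul_right_comm _ (r _ 1)] at h2
  linear_combination (norm := module) h2 - h1

end DunklRelations

end Spin

/-! ### The algebra of the two-index symmetries -/

section Symmetries

variable {B : Type*} [Ring B]

/-- An element commuting with the generators commutes with the pseudoscalar. -/
theorem CommutesWith.pseudoscalar_mul {e₁ e₂ e₃ c : B} (h : CommutesWith e₁ e₂ e₃ c) :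
    e₁ * e₂ * e₃ * c = c * (e₁ * e₂ * e₃) := by
  simp only [mul_assoc, h.rules]

variable [Algebra ℂ B] {ι : Type*} [Fintype ι]

/-- The commutator of two two-index symmetries `J(bᵢ - Oᵢ)`, from the relations of their parts. -/
theorem commutator_of_anticomm {J P c e₀ e₁ b₀ b₁ b₂ O₀ O₁ O₂ : B} (hJ : J * J = -1)
    (hJ₀ : J * (b₀ - O₀) = (b₀ - O₀) * J) (hJ₁ : J * (b₁ - O₁) = (b₁ - O₁) * J)
    (hJP : J * P = P * J)
    (hb₀ : P * e₀ + e₀ * P = (2 : ℂ) • b₀) (hb₁ : P * e₁ + e₁ * P = (2 : ℂ) • b₁)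
    (hb₂ : P * (e₀ * e₁) + e₀ * e₁ * P = (2 : ℂ) • (J * b₂))
    (hO₀ : O₀ * P = P * O₀) (hO₁ : O₁ * P = P * O₁) (hO₂ : O₂ * P = P * O₂)
    (hbb : b₀ * b₁ - b₁ * b₀ = P * (e₀ * e₁ * c) + e₀ * e₁ * c * P)
    (hleft : e₀ * O₁ - e₁ * O₀ = e₀ * e₁ * (c - (1 / 2 : ℂ) • 1) - J * O₂)
    (hright : O₀ * e₁ - O₁ * e₀ = e₀ * e₁ * (c - (1 / 2 : ℂ) • 1) - J * O₂) :
    J * (b₀ - O₀) * (J * (b₁ - O₁)) - J * (b₁ - O₁) * (J * (b₀ - O₀)) =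
      -(J * (b₂ - O₂) + (2 : ℂ) • (J * (P + (1 / 2 : ℂ) • 1) * O₂) + (O₀ * O₁ - O₁ * O₀)) := by
  have h1 : J * (b₀ - O₀) * (J * (b₁ - O₁)) = -((b₀ - O₀) * (b₁ - O₁)) := by
    rw [hJ₀, mul_assoc, ← mul_assoc J J, hJ, neg_one_mul, mul_neg]
  have h2 : J * (b₁ - O₁) * (J * (b₀ - O₀)) = -((b₁ - O₁) * (b₀ - O₀)) := by
    rw [hJ₁, mul_assoc, ← mul_assoc J J, hJ, neg_one_mul, mul_neg]
  obtain ⟨X, hX⟩ : ∃ X, X = e₀ * e₁ * (c - (1 / 2 : ℂ) • 1) - J * O₂ := ⟨_, rfl⟩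
  rw [← hX] at hleft hright
  have h3 : (2 : ℂ) • (b₀ * O₁ - b₁ * O₀) = P * X + X * P := by
    rw [smul_sub, ← smul_mul_assoc, ← smul_mul_assoc, ← hb₀, ← hb₁, ← hleft]
    simp only [add_mul, mul_sub, sub_mul, mul_assoc, hO₀, hO₁]
    abel
  have h4 : (2 : ℂ) • (O₀ * b₁ - O₁ * b₀) = P * X + X * P := by
    rw [smul_sub, ← mul_smul_comm, ← mul_smul_comm, ← hb₀, ← hb₁, ← hright]
    simp only [mul_add, mul_sub, sub_mul, ← mul_assoc, hO₀, hO₁]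
    abel
  have h5 : P * (J * O₂) + J * O₂ * P = (2 : ℂ) • (J * (P * O₂)) := by
    rw [mul_assoc, hO₂, ← mul_assoc, ← hJP, mul_assoc, two_smul]
  rw [h1, h2]
  rw [hX] at h3 h4
  simp only [mul_sub, sub_mul, mul_add, add_mul, mul_smul_comm, smul_mul_assoc, mul_one,
    mul_assoc] at h3 h4 h5 hbb hb₂ ⊢
  linear_combination (norm := module) (-1 : ℂ) • hbb + (1 / 2 : ℂ) • h3 + (1 / 2 : ℂ) • h4 -
    (1 / 2 : ℂ) • hb₂ - h5

/-- Half the anticommutator of the spin element with `eᵢ`, written out; see `spin_anticomm`. -/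
def halfAnti (e x D : Fin 3 → B) (κ : ι → ℂ) (σ : ι → B) (i : Fin 3) : B :=
  e i * shift κ σ - e 0 * e 1 * e 2 * angMom x D i

/-- The two-index symmetry belonging to the two indices other than `i`, as the pseudoscalar times
`½{P, eᵢ} - Oᵢ`, with `P` the spin element; `twoSym_eq` gives the usual expression. -/
def twoSym (e x D : Fin 3 → B) (r : ι → Fin 3 → ℂ) (κ : ι → ℂ) (σ : ι → B) (i : Fin 3) : B :=
  e 0 * e 1 * e 2 * (halfAnti e x D κ σ i - oneSym e r κ σ i)

/-- The three-index symmetry, as the pseudoscalar times `P + ½`, with `P` the spin element. -/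
def threeSym (e x D : Fin 3 → B) (κ : ι → ℂ) (σ : ι → B) : B :=
  e 0 * e 1 * e 2 * (spin e x D κ σ + (1 / 2 : ℂ) • 1)

variable {e x D : Fin 3 → B} {r : ι → Fin 3 → ℂ} {κ : ι → ℂ} {σ : ι → B}

namespace DunklRelations

theorem halfAnti_rotate (h : DunklRelations e x D r κ σ) (i : Fin 3) :
    halfAnti (fun i => e (i + 1)) (fun i => x (i + 1)) (fun i => D (i + 1)) κ σ i =
      halfAnti e x D κ σ (i + 1) := by
  change e (i + 1) * shift κ σ - e 1 * e 2 * e 0 * angMom _ _ i = _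
  rw [h.clifford.pseudoscalar_rotate, halfAnti]
  fin_cases i <;> rfl

theorem twoSym_rotate (h : DunklRelations e x D r κ σ) (i : Fin 3) :
    twoSym (fun i => e (i + 1)) (fun i => x (i + 1)) (fun i => D (i + 1))
      (fun n i => r n (i + 1)) κ σ i = twoSym e x D r κ σ (i + 1) := by
  rw [twoSym, h.halfAnti_rotate, oneSym_rotate, twoSym]
  change e 1 * e 2 * e 0 * _ = _
  rw [h.clifford.pseudoscalar_rotate]

theorem threeSym_rotate (h : DunklRelations e x D r κ σ) :
    threeSym (fun i => e (i + 1)) (fun i => x (i + 1)) (fun i => D (i + 1)) κ σ =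
      threeSym e x D κ σ := by
  rw [threeSym, spin_rotate, threeSym]
  change e 1 * e 2 * e 0 * _ = _
  rw [h.clifford.pseudoscalar_rotate]

theorem angMom_comm' (h : DunklRelations e x D r κ σ) (i : Fin 3) :
    angMom x D i * angMom x D (i + 1) - angMom x D (i + 1) * angMom x D i =
      -(shift κ σ * angMom x D (i + 2) + angMom x D (i + 2) * shift κ σ) := by
  fin_cases i
  · exact h.rotate.rotate.angMom_comm
  · exact h.angMom_comm
  · exact h.rotate.angMom_comm

theorem spin_mul_self (h : DunklRelations e x D r κ σ) :
    spin e x D κ σ * spin e x D κ σ = shift κ σ * shift κ σ -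
      angMom x D 0 * angMom x D 0 - angMom x D 1 * angMom x D 1 - angMom x D 2 * angMom x D 2 :=
  spinElement_mul_self h.clifford h.comm_shift (h.comm_angMom 0) (h.comm_angMom 1)
    (h.comm_angMom 2) (h.angMom_comm' 0) (h.angMom_comm' 1) (h.angMom_comm' 2)

theorem spin_anticomm_two (h : DunklRelations e x D r κ σ) :
    spin e x D κ σ * e 2 + e 2 * spin e x D κ σ = (2 : ℂ) • halfAnti e x D κ σ 2 := by
  rw [spin, spinElement_anticomm h.clifford h.comm_shift (h.comm_angMom 0) (h.comm_angMom 1)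
    (h.comm_angMom 2), halfAnti, two_mul, two_smul]

theorem spin_anticomm (h : DunklRelations e x D r κ σ) (i : Fin 3) :
    spin e x D κ σ * e i + e i * spin e x D κ σ = (2 : ℂ) • halfAnti e x D κ σ i := by
  fin_cases i
  · have := h.rotate.spin_anticomm_two
    rw [spin_rotate, h.halfAnti_rotate] at this
    exact this
  · have := h.rotate.rotate.spin_anticomm_two
    rw [h.rotate.halfAnti_rotate, h.halfAnti_rotate,
      spin_rotate (e := fun i => e (i + 1)) (x := fun i => x (i + 1)) (D := fun i => D (i + 1)),
      spin_rotate] at this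
    exact this
  · exact h.spin_anticomm_two

theorem halfAnti_eq (h : DunklRelations e x D r κ σ) (i : Fin 3) :
    halfAnti e x D κ σ i = (1 / 2 : ℂ) • (spin e x D κ σ * e i + e i * spin e x D κ σ) := by
  rw [h.spin_anticomm]
  module

theorem spin_mul_self_comm (h : DunklRelations e x D r κ σ) (i : Fin 3) :
    spin e x D κ σ * spin e x D κ σ * e i = e i * (spin e x D κ σ * spin e x D κ σ) := by
  rw [h.spin_mul_self]
  have h1 := ((h.comm_shift.mul h.comm_shift).sub ((h.comm_angMom 0).mul (h.comm_angMom 0))).sub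
    ((h.comm_angMom 1).mul (h.comm_angMom 1)) |>.sub ((h.comm_angMom 2).mul (h.comm_angMom 2))
  fin_cases i
  exacts [h1.comm₁, h1.comm₂, h1.comm₃]

/-- Since the square of the spin element commutes with `eᵢ`, the anticommutator of the two commutes
with the spin element. -/
theorem halfAnti_comm_spin (h : DunklRelations e x D r κ σ) (i : Fin 3) :
    halfAnti e x D κ σ i * spin e x D κ σ = spin e x D κ σ * halfAnti e x D κ σ i := by
  have h1 := h.spin_mul_self_comm i
  rw [h.halfAnti_eq, smul_mul_assoc, mul_smul_comm]
  simp only [mul_add, add_mul, mul_assoc] at h1 ⊢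
  rw [h1]
  abel_nf

theorem pseudoscalar_mul_e (h : DunklRelations e x D r κ σ) (i : Fin 3) :
    e 0 * e 1 * e 2 * e i = e i * (e 0 * e 1 * e 2) := by
  fin_cases i
  exacts [h.clifford.pseudoscalar.comm₁, h.clifford.pseudoscalar.comm₂,
    h.clifford.pseudoscalar.comm₃]

theorem pseudoscalar_mul_oneSym (h : DunklRelations e x D r κ σ) (i : Fin 3) :
    e 0 * e 1 * e 2 * oneSym e r κ σ i = oneSym e r κ σ i * (e 0 * e 1 * e 2) := by
  have h1 : ∀ n, e 0 * e 1 * e 2 * (cliffordVec e (r n) * σ n) =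
      cliffordVec e (r n) * σ n * (e 0 * e 1 * e 2) := by
    intro n
    rw [mul_assoc _ (σ n), ← (h.comm_σ n).pseudoscalar_mul, ← mul_assoc, ← mul_assoc]
    congr 1
    simp only [cliffordVec, mul_add, add_mul, mul_smul_comm, smul_mul_assoc, h.pseudoscalar_mul_e]
  simp only [oneSym, Finset.mul_sum, Finset.sum_mul, mul_smul_comm, smul_mul_assoc, h1]

theorem pseudoscalar_mul_spin (h : DunklRelations e x D r κ σ) :
    e 0 * e 1 * e 2 * spin e x D κ σ = spin e x D κ σ * (e 0 * e 1 * e 2) := by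
  obtain ⟨J, hJ⟩ : ∃ J, J = e 0 * e 1 * e 2 := ⟨_, rfl⟩
  have he := h.pseudoscalar_mul_e
  have hc := h.comm_shift.pseudoscalar_mul
  have hm := fun i => (h.comm_angMom i).pseudoscalar_mul
  rw [← hJ] at hc ⊢
  simp only [← hJ] at he hm
  have h1 : ∀ i j k, J * (e i * e j * angMom x D k) = e i * e j * angMom x D k * J := by
    intro i j k
    rw [mul_assoc _ _ J, ← hm, ← mul_assoc, ← mul_assoc, he, mul_assoc (e i), he, ← mul_assoc,
      ← mul_assoc]
  simp only [spin, spinElement, mul_sub, sub_mul, hc, h1]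

theorem pseudoscalar_mul_halfAnti (h : DunklRelations e x D r κ σ) (i : Fin 3) :
    e 0 * e 1 * e 2 * halfAnti e x D κ σ i = halfAnti e x D κ σ i * (e 0 * e 1 * e 2) := by
  have he : Commute (e 0 * e 1 * e 2) (e i) := h.pseudoscalar_mul_e i
  have hP : Commute (e 0 * e 1 * e 2) (spin e x D κ σ) := h.pseudoscalar_mul_spin
  rw [h.halfAnti_eq]
  exact ((hP.mul_right he).add_right (he.mul_right hP)).smul_right _

theorem twoSym_two_eq (h : DunklRelations e x D r κ σ) :
    (x 0 * D 1 - x 1 * D 0) + (1 / 2 : ℂ) • (e 0 * e 1) + oneSym e r κ σ 0 * e 1 -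
      oneSym e r κ σ 1 * e 0 = twoSym e x D r κ σ 2 := by
  have h1 := h.oneSym_cross_e
  have h2 : e 0 * e 1 * e 2 * e 2 = e 0 * e 1 := by
    rw [mul_assoc _ _ (e 2), h.clifford.sq₃, mul_one]
  have h3 : angMom x D 2 = x 0 * D 1 - x 1 * D 0 := rfl
  rw [twoSym, halfAnti, mul_sub, mul_sub, ← mul_assoc,
    ← mul_assoc (e 0 * e 1 * e 2) _ (angMom _ _ _), h2, h.clifford.pseudoscalar_mul_self, h3]
  simp only [mul_sub, mul_smul_comm, mul_one, neg_one_mul] at h1 ⊢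
  linear_combination (norm := module) h1

/-- The two-index symmetries are the angular momenta corrected by a Clifford bivector and by the
one-index symmetries. -/
theorem twoSym_eq (h : DunklRelations e x D r κ σ) (i : Fin 3) :
    (x i * D (i + 1) - x (i + 1) * D i) + (1 / 2 : ℂ) • (e i * e (i + 1)) +
      oneSym e r κ σ i * e (i + 1) - oneSym e r κ σ (i + 1) * e i =
        twoSym e x D r κ σ (i + 2) := by
  fin_cases i
  · exact h.twoSym_two_eq
  · have := h.rotate.twoSym_two_eq
    simp only [h.twoSym_rotate, oneSym_rotate] at this
    exact this
  · have := h.rotate.rotate.twoSym_two_eq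
    rw [h.rotate.twoSym_rotate, h.twoSym_rotate,
      oneSym_rotate (e := fun i => e (i + 1)) (r := fun n i => r n (i + 1)), oneSym_rotate,
      oneSym_rotate (e := fun i => e (i + 1)) (r := fun n i => r n (i + 1)), oneSym_rotate] at this
    exact this

/-- The deformation of `so(3)` satisfied by the two-index symmetries. -/
theorem twoSym_commutator_zero (h : DunklRelations e x D r κ σ) :
    twoSym e x D r κ σ 0 * twoSym e x D r κ σ 1 - twoSym e x D r κ σ 1 * twoSym e x D r κ σ 0 =
      -(twoSym e x D r κ σ 2 + (2 : ℂ) • (threeSym e x D κ σ * oneSym e r κ σ 2) +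
        (oneSym e r κ σ 0 * oneSym e r κ σ 1 - oneSym e r κ σ 1 * oneSym e r κ σ 0)) := by
  have hJ : ∀ i, e 0 * e 1 * e 2 * (halfAnti e x D κ σ i - oneSym e r κ σ i) =
      (halfAnti e x D κ σ i - oneSym e r κ σ i) * (e 0 * e 1 * e 2) := fun i => by
    rw [mul_sub, sub_mul, h.pseudoscalar_mul_halfAnti, h.pseudoscalar_mul_oneSym]
  refine commutator_of_anticomm h.clifford.pseudoscalar_mul_self (hJ 0) (hJ 1)
    h.pseudoscalar_mul_spin (h.spin_anticomm 0) (h.spin_anticomm 1) ?_ (h.oneSym_comm_spin 0)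
    (h.oneSym_comm_spin 1) (h.oneSym_comm_spin 2) ?_ h.e_cross_oneSym h.oneSym_cross_e
  · have h1 : e 0 * e 1 = e 0 * e 1 * e 2 * e 2 := by
      rw [mul_assoc _ _ (e 2), h.clifford.sq₃, mul_one]
    have h2 := h.pseudoscalar_mul_spin
    rw [← mul_smul_comm, ← h.spin_anticomm 2]
    nth_rewrite 1 2 [h1]
    rw [mul_add, ← mul_assoc (spin e x D κ σ), ← h2, mul_assoc _ _ (e 2),
      mul_assoc _ (e 2) (spin e x D κ σ)]
  · exact anticomm_commutator h.clifford h.comm_shift (h.comm_angMom 0) (h.comm_angMom 1)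
      (h.comm_angMom 2) (h.angMom_comm' 0)

theorem twoSym_commutator (h : DunklRelations e x D r κ σ) (i : Fin 3) :
    twoSym e x D r κ σ i * twoSym e x D r κ σ (i + 1) -
        twoSym e x D r κ σ (i + 1) * twoSym e x D r κ σ i =
      -(twoSym e x D r κ σ (i + 2) + (2 : ℂ) • (threeSym e x D κ σ * oneSym e r κ σ (i + 2)) +
        (oneSym e r κ σ i * oneSym e r κ σ (i + 1) -
          oneSym e r κ σ (i + 1) * oneSym e r κ σ i)) := by
  fin_cases i
  · exact h.twoSym_commutator_zero
  · have := h.rotate.twoSym_commutator_zero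
    simp only [h.twoSym_rotate, h.threeSym_rotate, oneSym_rotate] at this
    exact this
  · have := h.rotate.rotate.twoSym_commutator_zero
    simp only [h.rotate.twoSym_rotate, h.twoSym_rotate, h.rotate.threeSym_rotate,
      h.threeSym_rotate] at this
    rw [oneSym_rotate (e := fun i => e (i + 1)) (r := fun n i => r n (i + 1)), oneSym_rotate,
      oneSym_rotate (e := fun i => e (i + 1)) (r := fun n i => r n (i + 1)), oneSym_rotate,
      oneSym_rotate (e := fun i => e (i + 1)) (r := fun n i => r n (i + 1)), oneSym_rotate] at this
    exact this

/-- The sum of the squares of the two-index symmetries, which makes the products of the raising and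
lowering combinations polynomials in the remaining symmetries. -/
theorem twoSym_casimir (h : DunklRelations e x D r κ σ) :
    twoSym e x D r κ σ 0 * twoSym e x D r κ σ 0 + twoSym e x D r κ σ 1 * twoSym e x D r κ σ 1 +
        twoSym e x D r κ σ 2 * twoSym e x D r κ σ 2 =
      threeSym e x D κ σ * threeSym e x D κ σ + (1 / 4 : ℂ) • 1 -
        (oneSym e r κ σ 0 * oneSym e r κ σ 0 + oneSym e r κ σ 1 * oneSym e r κ σ 1 +
          oneSym e r κ σ 2 * oneSym e r κ σ 2) := by
  have hsq : ∀ {a : B}, e 0 * e 1 * e 2 * a = a * (e 0 * e 1 * e 2) →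
      e 0 * e 1 * e 2 * a * (e 0 * e 1 * e 2 * a) = -(a * a) := by
    intro a ha
    nth_rewrite 1 [ha]
    rw [mul_assoc, ← mul_assoc _ _ a, h.clifford.pseudoscalar_mul_self, neg_one_mul, mul_neg]
  have hA : ∀ i, twoSym e x D r κ σ i * twoSym e x D r κ σ i =
      -((halfAnti e x D κ σ i - oneSym e r κ σ i) * (halfAnti e x D κ σ i - oneSym e r κ σ i)) :=
    fun i => hsq (by rw [mul_sub, sub_mul, h.pseudoscalar_mul_halfAnti, h.pseudoscalar_mul_oneSym])
  have hW : threeSym e x D κ σ * threeSym e x D κ σ =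
      -((spin e x D κ σ + (1 / 2 : ℂ) • 1) * (spin e x D κ σ + (1 / 2 : ℂ) • 1)) :=
    hsq (by rw [mul_add, add_mul, h.pseudoscalar_mul_spin, mul_smul_comm, smul_mul_assoc, mul_one,
      one_mul])
  have hbO : ∀ i, halfAnti e x D κ σ i * oneSym e r κ σ i +
      oneSym e r κ σ i * halfAnti e x D κ σ i =
      (1 / 2 : ℂ) • (spin e x D κ σ * (e i * oneSym e r κ σ i + oneSym e r κ σ i * e i) +
        (e i * oneSym e r κ σ i + oneSym e r κ σ i * e i) * spin e x D κ σ) := by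
    intro i
    have h1 := h.oneSym_comm_spin i
    have h2 : ∀ z, oneSym e r κ σ i * (spin e x D κ σ * z) =
        spin e x D κ σ * (oneSym e r κ σ i * z) := by
      intro z
      rw [← mul_assoc, h1, mul_assoc]
    rw [h.halfAnti_eq]
    simp only [mul_smul_comm, smul_mul_assoc, mul_add, add_mul, mul_assoc, h1, h2]
    module
  have hsum := h.sum_e_anticomm_oneSym
  have hP := congrArg (spin e x D κ σ * ·) hsum
  have hP' := congrArg (· * spin e x D κ σ) hsum
  have hbb : halfAnti e x D κ σ 0 * halfAnti e x D κ σ 0 +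
      halfAnti e x D κ σ 1 * halfAnti e x D κ σ 1 + halfAnti e x D κ σ 2 * halfAnti e x D κ σ 2 =
      spin e x D κ σ * spin e x D κ σ +
        (shift κ σ * spin e x D κ σ + spin e x D κ σ * shift κ σ) := by
    rw [h.spin_mul_self]
    exact sum_anticomm_mul_self h.clifford h.comm_shift (h.comm_angMom 0) (h.comm_angMom 1)
      (h.comm_angMom 2)
  have hb0 := hbO 0
  have hb1 := hbO 1
  have hb2 := hbO 2
  rw [hA, hA, hA, hW]
  simp only [mul_add, add_mul, mul_sub, sub_mul, mul_smul_comm, smul_mul_assoc, mul_one, one_mul,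
    smul_add] at hP hP' hb0 hb1 hb2 ⊢
  linear_combination (norm := module) (-1 : ℂ) • hbb + hb0 + hb1 + hb2 + (1 / 2 : ℂ) • hP +
    (1 / 2 : ℂ) • hP'

theorem threeSym_comm_oneSym (h : DunklRelations e x D r κ σ) (i : Fin 3) :
    Commute (threeSym e x D κ σ) (oneSym e r κ σ i) :=
  Commute.mul_left (h.pseudoscalar_mul_oneSym i)
    (Commute.add_left (h.oneSym_comm_spin i).symm ((Commute.one_left _).smul_left _))

theorem threeSym_comm_twoSym (h : DunklRelations e x D r κ σ) (i : Fin 3) :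
    Commute (threeSym e x D κ σ) (twoSym e x D r κ σ i) := by
  have h1 : Commute (threeSym e x D κ σ) (halfAnti e x D κ σ i) :=
    Commute.mul_left (h.pseudoscalar_mul_halfAnti i)
      (Commute.add_left (h.halfAnti_comm_spin i).symm ((Commute.one_left _).smul_left _))
  have h2 : Commute (threeSym e x D κ σ) (e 0 * e 1 * e 2) :=
    Commute.mul_left (Commute.refl _)
      (Commute.add_left h.pseudoscalar_mul_spin.symm ((Commute.one_left _).smul_left _))
  exact h2.mul_right (h1.sub_right (h.threeSym_comm_oneSym i))

end DunklRelations

end Symmetries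

/-! ### Root systems that split off the third axis -/

/-- Every root lies in the plane of the first two coordinates or on the third axis. -/
def IsSplit {ι : Type*} (r : ι → Fin 3 → ℂ) : Prop := ∀ n, r n 2 = 0 ∨ (r n 0 = 0 ∧ r n 1 = 0)

theorem IsSplit.mul_two_zero {ι : Type*} {r : ι → Fin 3 → ℂ} (hr : IsSplit r) (n : ι) :
    r n 2 * r n 0 = 0 := by
  rcases hr n with h | h <;> simp [h]

theorem IsSplit.mul_two_one {ι : Type*} {r : ι → Fin 3 → ℂ} (hr : IsSplit r) (n : ι) :
    r n 2 * r n 1 = 0 := by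
  rcases hr n with h | h <;> simp [h]

section Split

variable {B : Type*} [Ring B] [Algebra ℂ B] {ι : Type*} [Fintype ι]
variable {e x D : Fin 3 → B} {r : ι → Fin 3 → ℂ} {κ : ι → ℂ} {σ : ι → B}

namespace DunklRelations

/-- `Oᵢ` anticommutes with `eⱼ` if no root has a component both along `i` and along `j`. -/
theorem oneSym_mul_e_of_mul_eq_zero (h : DunklRelations e x D r κ σ) {i j : Fin 3}
    (hr : ∀ n, r n i * r n j = 0) : oneSym e r κ σ i * e j = -(e j * oneSym e r κ σ i) := by
  rw [← add_eq_zero_iff_eq_neg, add_comm, h.e_anticomm_oneSym]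
  refine Finset.sum_eq_zero fun n _ => ?_
  rw [mul_assoc, mul_assoc, mul_comm (r n j), hr, mul_zero, mul_zero, zero_smul]

theorem oneSym_two_mul_e_two (h : DunklRelations e x D r κ σ) (hr : IsSplit r) :
    oneSym e r κ σ 2 * e 2 = e 2 * oneSym e r κ σ 2 := by
  simp only [oneSym, Finset.sum_mul, Finset.mul_sum, smul_mul_assoc, mul_smul_comm]
  refine Finset.sum_congr rfl fun n _ => ?_
  rcases hr n with h0 | ⟨h0, h1⟩
  · simp [h0]
  · simp only [cliffordVec, h0, h1, zero_smul, zero_add, smul_mul_assoc, mul_smul_comm, mul_assoc,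
      (h.comm_σ n).comm₃]

/-- The planar elements `σ̃_r` anticommute with those of the third axis, because such roots are
orthogonal and their reflections commute. -/
theorem oneSym_two_mul_oneSym (h : DunklRelations e x D r κ σ) (hr : IsSplit r)
    (hσ : ∀ a b, r a 2 = 0 → r b 0 = 0 → r b 1 = 0 → σ b * σ a = σ a * σ b)
    {i : Fin 3} (hi : i ≠ 2) :
    oneSym e r κ σ 2 * oneSym e r κ σ i = -(oneSym e r κ σ i * oneSym e r κ σ 2) := by
  simp only [oneSym, Finset.sum_mul_sum, smul_mul_assoc, mul_smul_comm]
  rw [Finset.sum_comm, ← Finset.sum_neg_distrib]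
  refine Finset.sum_congr rfl fun a _ => ?_
  rw [← Finset.sum_neg_distrib]
  refine Finset.sum_congr rfl fun b _ => ?_
  rcases hr a with ha | ⟨ha0, ha1⟩
  · rcases hr b with hb | ⟨hb0, hb1⟩
    · simp [hb]
    · have hab := hσ a b ha hb0 hb1
      simp only [cliffordVec, ha, hb0, hb1, zero_smul, zero_add, add_zero, mul_add, add_mul,
        smul_mul_assoc, mul_smul_comm, mul_assoc, (h.comm_σ _).rules, hab, h.clifford.rules]
      module
  · have : r a i = 0 := by
      fin_cases i
      exacts [ha0, ha1, absurd rfl hi]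
    simp [this]

theorem anticomm_halfAnti (h : DunklRelations e x D r κ σ) {O : B} {i : Fin 3}
    (hP : O * spin e x D κ σ = spin e x D κ σ * O) (he : O * e i = -(e i * O)) :
    O * halfAnti e x D κ σ i = -(halfAnti e x D κ σ i * O) := by
  have h1 : ∀ z, O * (spin e x D κ σ * z) = spin e x D κ σ * (O * z) := fun z => by
    rw [← mul_assoc, hP, mul_assoc]
  have h2 : ∀ z, O * (e i * z) = -(e i * (O * z)) := fun z => by
    rw [← mul_assoc, he, neg_mul, mul_assoc]
  rw [h.halfAnti_eq]
  simp only [mul_smul_comm, smul_mul_assoc, mul_add, add_mul, mul_assoc, h1, h2, hP, he, mul_neg]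
  module

theorem comm_halfAnti (h : DunklRelations e x D r κ σ) {O : B} {i : Fin 3}
    (hP : Commute O (spin e x D κ σ)) (he : Commute O (e i)) :
    Commute O (halfAnti e x D κ σ i) := by
  rw [h.halfAnti_eq]
  exact ((hP.mul_right he).add_right (he.mul_right hP)).smul_right _

theorem oneSym_mul_twoSym (h : DunklRelations e x D r κ σ) {i j : Fin 3}
    (he : oneSym e r κ σ i * e j = -(e j * oneSym e r κ σ i))
    (hO : oneSym e r κ σ i * oneSym e r κ σ j = -(oneSym e r κ σ j * oneSym e r κ σ i)) :
    oneSym e r κ σ i * twoSym e x D r κ σ j = -(twoSym e x D r κ σ j * oneSym e r κ σ i) := by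
  rw [twoSym, ← mul_assoc, ← h.pseudoscalar_mul_oneSym, mul_assoc, mul_assoc _ _ (oneSym e r κ σ i),
    ← mul_neg, mul_sub, sub_mul, h.anticomm_halfAnti (h.oneSym_comm_spin i) he, hO]
  congr 1
  abel

theorem oneSym_two_mul_twoSym_two (h : DunklRelations e x D r κ σ) (hr : IsSplit r) :
    Commute (oneSym e r κ σ 2) (twoSym e x D r κ σ 2) :=
  Commute.mul_right (h.pseudoscalar_mul_oneSym 2).symm
    ((h.comm_halfAnti (h.oneSym_comm_spin 2) (h.oneSym_two_mul_e_two hr)).sub_right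
      (Commute.refl _))

/-- With `O± = O₁ ± iO₂` and `e± = e₁ ± ie₂`, one has `O₋e₊ = e₋O₊`, and likewise with `-i` in
place of `i`. -/
theorem oneSym_mul_isotropic (h : DunklRelations e x D r κ σ) (hr : IsSplit r) {t : ℂ}
    (ht : t * t = -1) :
    (oneSym e r κ σ 0 - t • oneSym e r κ σ 1) * (e 0 + t • e 1) =
      (e 0 - t • e 1) * (oneSym e r κ σ 0 + t • oneSym e r κ σ 1) := by
  have h1 : oneSym e r κ σ 0 - t • oneSym e r κ σ 1 =
      ∑ n, (κ n * (r n 0 - t * r n 1)) • (cliffordVec e (r n) * σ n) := by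
    simp only [oneSym, Finset.smul_sum, ← Finset.sum_sub_distrib]
    exact Finset.sum_congr rfl fun n _ => by module
  have h2 : oneSym e r κ σ 0 + t • oneSym e r κ σ 1 =
      ∑ n, (κ n * (r n 0 + t * r n 1)) • (cliffordVec e (r n) * σ n) := by
    simp only [oneSym, Finset.smul_sum, ← Finset.sum_add_distrib]
    exact Finset.sum_congr rfl fun n _ => by module
  rw [h1, h2, Finset.sum_mul, Finset.mul_sum]
  refine Finset.sum_congr rfl fun n _ => ?_
  rw [smul_mul_assoc, mul_smul_comm, mul_smul]
  conv_rhs => rw [mul_smul]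
  congr 1
  -- For a root on the third axis both sides vanish; for a planar root, both coefficients times the
  -- isotropic vectors are compared by means of `r₁e₁ + r₂e₂` having square `1`.
  have hu := h.unit n
  rcases hr n with h0 | ⟨h0, h1⟩
  · have h3 : cliffordVec e (r n) * (cliffordVec e (r n) * σ n) = σ n := by
      rw [← mul_assoc, h.cliffordVec_mul_self, one_mul]
    have h4 : r n 0 • (e 0 * (cliffordVec e (r n) * σ n)) +
        r n 1 • (e 1 * (cliffordVec e (r n) * σ n)) = σ n := by
      conv_rhs => rw [← h3]
      nth_rewrite 3 [cliffordVec]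
      simp only [h0, zero_smul, add_zero, add_mul, smul_mul_assoc]
    rw [h0] at hu
    simp only [mul_add, mul_smul_comm, h.tilde_mul_e, sub_mul, smul_mul_assoc]
    linear_combination (norm := module) (-2 : ℂ) • h4 + (2 * hu) • σ n +
      (2 * r n 1 * ht) • (e 1 * (cliffordVec e (r n) * σ n)) - (2 * r n 1 * r n 1 * ht) • σ n
  · rw [h0, h1, mul_zero, sub_zero, add_zero, zero_smul, zero_smul]

theorem oneSym_mul_twoSym_isotropic (h : DunklRelations e x D r κ σ) (hr : IsSplit r) {t : ℂ}
    (ht : t * t = -1) :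
    (oneSym e r κ σ 0 - t • oneSym e r κ σ 1) * (twoSym e x D r κ σ 0 + t • twoSym e x D r κ σ 1) =
      (twoSym e x D r κ σ 0 - t • twoSym e x D r κ σ 1) *
        (oneSym e r κ σ 0 + t • oneSym e r κ σ 1) := by
  have he := h.oneSym_mul_isotropic hr ht
  obtain ⟨V, hV⟩ : ∃ V, V = oneSym e r κ σ 0 - t • oneSym e r κ σ 1 := ⟨_, rfl⟩
  obtain ⟨U, hU⟩ : ∃ U, U = oneSym e r κ σ 0 + t • oneSym e r κ σ 1 := ⟨_, rfl⟩
  have hVP : Commute V (spin e x D κ σ) := by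
    rw [hV]
    exact Commute.sub_left (h.oneSym_comm_spin 0) (Commute.smul_left (h.oneSym_comm_spin 1) t)
  have hUP : Commute U (spin e x D κ σ) := by
    rw [hU]
    exact Commute.add_left (h.oneSym_comm_spin 0) (Commute.smul_left (h.oneSym_comm_spin 1) t)
  have hVJ : Commute V (e 0 * e 1 * e 2) := by
    rw [hV]
    exact Commute.sub_left (h.pseudoscalar_mul_oneSym 0).symm
      (Commute.smul_left (h.pseudoscalar_mul_oneSym 1).symm t)
  have hb : V * (halfAnti e x D κ σ 0 + t • halfAnti e x D κ σ 1) =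
      (halfAnti e x D κ σ 0 - t • halfAnti e x D κ σ 1) * U := by
    have h1 : halfAnti e x D κ σ 0 + t • halfAnti e x D κ σ 1 =
        (1 / 2 : ℂ) • (spin e x D κ σ * (e 0 + t • e 1) + (e 0 + t • e 1) * spin e x D κ σ) := by
      simp only [h.halfAnti_eq, mul_add, add_mul, mul_smul_comm, smul_mul_assoc]
      module
    have h2 : halfAnti e x D κ σ 0 - t • halfAnti e x D κ σ 1 =
        (1 / 2 : ℂ) • (spin e x D κ σ * (e 0 - t • e 1) + (e 0 - t • e 1) * spin e x D κ σ) := by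
      simp only [h.halfAnti_eq, mul_sub, sub_mul, mul_smul_comm, smul_mul_assoc]
      module
    rw [← hV, ← hU] at he
    rw [h1, h2]
    generalize e 0 + t • e 1 = p at he ⊢
    generalize e 0 - t • e 1 = q at he ⊢
    rw [mul_smul_comm, smul_mul_assoc, mul_add, add_mul, ← mul_assoc, hVP.eq, mul_assoc,
      ← mul_assoc V p, he, mul_assoc q, hUP.eq, mul_assoc, mul_assoc]
  have hA : twoSym e x D r κ σ 0 + t • twoSym e x D r κ σ 1 = e 0 * e 1 * e 2 *
      (halfAnti e x D κ σ 0 + t • halfAnti e x D κ σ 1 - U) := by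
    rw [hU]
    simp only [twoSym, mul_add, mul_sub, mul_smul_comm, smul_sub]
    abel
  have hA' : twoSym e x D r κ σ 0 - t • twoSym e x D r κ σ 1 = e 0 * e 1 * e 2 *
      (halfAnti e x D κ σ 0 - t • halfAnti e x D κ σ 1 - V) := by
    rw [hV]
    simp only [twoSym, mul_sub, mul_smul_comm, smul_sub]
    abel
  rw [hA, hA', ← hV, ← hU, ← mul_assoc, hVJ.eq, mul_assoc _ V, mul_assoc _ _ U, mul_sub, sub_mul,
    hb]

/-- The ladder relations and the factorisations for a root system that splits off the third
axis. -/
theorem ladder (h : DunklRelations e x D r κ σ) (hr : IsSplit r)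
    (hσ : ∀ a b, r a 2 = 0 → r b 0 = 0 → r b 1 = 0 → σ b * σ a = σ a * σ b)
    {H E F T U V W L M k : B} (hH : H = -(Complex.I • twoSym e x D r κ σ 2))
    (hE : E = Complex.I • twoSym e x D r κ σ 1 + twoSym e x D r κ σ 0)
    (hF : F = Complex.I • twoSym e x D r κ σ 1 - twoSym e x D r κ σ 0)
    (hT : T = Complex.I • oneSym e r κ σ 2)
    (hU : U = oneSym e r κ σ 0 + Complex.I • oneSym e r κ σ 1)
    (hV : V = oneSym e r κ σ 0 - Complex.I • oneSym e r κ σ 1) (hW : W = threeSym e x D κ σ)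
    (hL : L = (1 / 2 : ℂ) • (H * E + E * H)) (hM : M = (1 / 2 : ℂ) • (H * F + F * H))
    (hk : k = algebraMap ℂ B (1 / 2)) :
    H * L - L * H = L ∧ H * M - M * H = -M ∧
    L * M = -(((H - k) ^ 2 + (W + T) ^ 2) * ((H - k) ^ 2 - U * V)) ∧
    M * L = -(((H + k) ^ 2 + (W - T) ^ 2) * ((H + k) ^ 2 - V * U)) := by
  have h20 := h.oneSym_two_mul_oneSym hr hσ (i := 0) (by decide)
  have h21 := h.oneSym_two_mul_oneSym hr hσ (i := 1) (by decide)
  have h02 : oneSym e r κ σ 0 * e 2 = -(e 2 * oneSym e r κ σ 0) :=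
    h.oneSym_mul_e_of_mul_eq_zero fun n => by rw [mul_comm, hr.mul_two_zero]
  have h12 : oneSym e r κ σ 1 * e 2 = -(e 2 * oneSym e r κ σ 1) :=
    h.oneSym_mul_e_of_mul_eq_zero fun n => by rw [mul_comm, hr.mul_two_one]
  have hA0 := h.oneSym_mul_twoSym h02 (by rw [h20, neg_neg])
  have hA1 := h.oneSym_mul_twoSym h12 (by rw [h21, neg_neg])
  have hI : Complex.I * Complex.I = -1 := Complex.I_mul_I
  have hiso := h.oneSym_mul_twoSym_isotropic hr hI
  have hiso' := h.oneSym_mul_twoSym_isotropic hr (t := -Complex.I) (by rw [neg_mul_neg, hI])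
  have c12 := h.twoSym_commutator 0
  have c23 := h.twoSym_commutator 1
  have c31 := h.twoSym_commutator 2
  simp only [zero_add, Fin.reduceAdd] at c12 c23 c31
  rw [hL, hM, hk, hW]
  refine ladder_of_relations c12 c23 c31 h.twoSym_casimir
    (h.threeSym_comm_twoSym 0) (h.threeSym_comm_twoSym 1) (h.threeSym_comm_twoSym 2)
    (h.threeSym_comm_oneSym 0) (h.threeSym_comm_oneSym 1) (h.threeSym_comm_oneSym 2)
    (h.oneSym_two_mul_twoSym_two hr)
    (h.oneSym_mul_twoSym (h.oneSym_mul_e_of_mul_eq_zero hr.mul_two_zero) h20)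
    (h.oneSym_mul_twoSym (h.oneSym_mul_e_of_mul_eq_zero hr.mul_two_one) h21)
    h20 h21 (by rw [hA0, neg_neg]) (by rw [hA1, neg_neg]) ?_ ?_ hH hE hF hT hU hV
  · simp only [mul_add, mul_sub, add_mul, sub_mul, mul_smul_comm, smul_mul_assoc] at hiso' ⊢
    linear_combination (norm := module) -hiso'
  · simp only [mul_add, sub_mul, mul_smul_comm, smul_mul_assoc] at hiso ⊢
    linear_combination (norm := module) hiso

end DunklRelations

end Split

/-! ### The relations in `Cl(3) ⊗ 𝒜` -/

section Concrete

variable (m : ℕ) (κ : E3 → ℂ)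

/-- The embedding of `𝒜` into `Cl(3) ⊗ 𝒜`. -/
def inclA : dunklAlgebra m κ →ₐ[ℂ] ClA m κ := Algebra.TensorProduct.includeRight

/-- The multiplication operator `xᵢ` in `𝒜`. -/
def xA (i : Fin 3) : dunklAlgebra m κ := ⟨mulX i, Algebra.subset_adjoin (Or.inr ⟨i, rfl⟩)⟩

/-- The Dunkl operator `Dᵢ` in `𝒜`. -/
def dA (i : Fin 3) : dunklAlgebra m κ :=
  ⟨dunkl m κ i, Algebra.subset_adjoin (Or.inl (Or.inr ⟨i, rfl⟩))⟩

/-- The reflection `σⱼ` in `𝒜`. -/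
def sA (n : Fin (m + 1)) : dunklAlgebra m κ :=
  ⟨reflOp (root m n), Algebra.subset_adjoin (Or.inl (Or.inl ⟨_, (sigma m n).2, rfl⟩))⟩

theorem x_eq (i : Fin 3) : x m κ i = inclA m κ (xA m κ i) := rfl

theorem D_eq (i : Fin 3) : D m κ i = inclA m κ (dA m κ i) := rfl

theorem grp_sigma_eq (n : Fin (m + 1)) : grp m κ (sigma m n) = inclA m κ (sA m κ n) := rfl

theorem e_mul_inclA (i : Fin 3) (a : dunklAlgebra m κ) :
    inclA m κ a * e m κ i = e m κ i * inclA m κ a := by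
  rw [e, inclA, Algebra.TensorProduct.includeRight_apply, Algebra.TensorProduct.tmul_mul_tmul,
    Algebra.TensorProduct.tmul_mul_tmul, one_mul, mul_one, mul_one, one_mul]

theorem e_mul_self (i : Fin 3) : e m κ i * e m κ i = 1 := by
  rw [e, Algebra.TensorProduct.tmul_mul_tmul, CliffordAlgebra.ι_sq_scalar, mul_one]
  have : quadForm (Pi.single i 1) = 1 := by
    simp [quadForm, QuadraticMap.weightedSumSquares_apply, Pi.single_apply]
  rw [this, map_one, Algebra.TensorProduct.one_def]

theorem e_mul_e {i j : Fin 3} (hij : i ≠ j) : e m κ i * e m κ j = -(e m κ j * e m κ i) := by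
  rw [e, e, Algebra.TensorProduct.tmul_mul_tmul, Algebra.TensorProduct.tmul_mul_tmul, mul_one,
    ← TensorProduct.neg_tmul, ← sub_eq_zero, ← TensorProduct.sub_tmul, sub_neg_eq_add,
    CliffordAlgebra.ι_mul_ι_add_swap]
  have : QuadraticMap.polar quadForm (Pi.single i 1) (Pi.single j 1) = 0 := by
    fin_cases i <;> fin_cases j <;> first
      | exact absurd rfl hij
      | simp [QuadraticMap.polar, quadForm, QuadraticMap.weightedSumSquares_apply,
          Fin.sum_univ_three]
  rw [this, map_zero, TensorProduct.zero_tmul]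

/-- The coordinates of the positive roots. -/
def rootCoord (n : Fin (m + 1)) (i : Fin 3) : ℂ := ((root m n i : ℝ) : ℂ)

theorem isSplit_rootCoord : IsSplit (rootCoord m) := by
  intro n
  cases n using Fin.cases with
  | zero => right; simp [rootCoord, root_zero]
  | succ n => left; simp [rootCoord, root]

variable {m κ}

theorem dunklRelations (hm : m ≠ 0) (hκ : IsInvariant m κ) :
    DunklRelations (e m κ) (x m κ) (D m κ) (rootCoord m) (fun n => κ (root m n))
      (fun n => grp m κ (sigma m n)) where
  unit n := by
    have := inner_root_self m n
    rw [inner_eq_sum, Fin.sum_univ_three] at this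
    simp only [rootCoord]
    exact_mod_cast this
  clifford := ⟨e_mul_self m κ 0, e_mul_self m κ 1, e_mul_self m κ 2, e_mul_e m κ (by decide),
    e_mul_e m κ (by decide), e_mul_e m κ (by decide)⟩
  comm_x i := ⟨e_mul_inclA m κ 0 _, e_mul_inclA m κ 1 _, e_mul_inclA m κ 2 _⟩
  comm_D i := ⟨e_mul_inclA m κ 0 _, e_mul_inclA m κ 1 _, e_mul_inclA m κ 2 _⟩
  comm_σ n := ⟨e_mul_inclA m κ 0 _, e_mul_inclA m κ 1 _, e_mul_inclA m κ 2 _⟩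
  x_x i j := by
    have : xA m κ i * xA m κ j = xA m κ j * xA m κ i := Subtype.ext (mulX_mul_mulX i j)
    simp only [x_eq, ← map_mul, this]
  D_D i j := by
    have : dA m κ i * dA m κ j = dA m κ j * dA m κ i := Subtype.ext (dunkl_comm hm hκ i j)
    simp only [D_eq, ← map_mul, this]
  D_x i j := by
    have : dA m κ i * xA m κ j = xA m κ j * dA m κ i + ((if i = j then 1 else 0) +
        ∑ n : Fin (m + 1), (2 * κ (root m n) * rootCoord m n i * rootCoord m n j) • sA m κ n) := by
      apply Subtype.ext
      have h := dunkl_mul_mulX (m := m) (κ := κ) i j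
      rw [Finset.sum_range] at h
      push_cast
      split_ifs at h ⊢
      · exact h
      · exact h
    simp only [x_eq, D_eq, grp_sigma_eq, ← map_mul, this]
    simp only [map_add, map_sum, map_smul]
    split_ifs <;> simp
  σ_x n i := by
    have : sA m κ n * xA m κ i = (xA m κ i - (2 * rootCoord m n i) •
        (rootCoord m n 0 • xA m κ 0 + rootCoord m n 1 • xA m κ 1 + rootCoord m n 2 • xA m κ 2)) *
          sA m κ n := by
      apply Subtype.ext
      have h := reflOp_mul_mulX (inner_root_self m n) i
      rw [Fin.sum_univ_three] at h
      exact h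
    simp only [x_eq, grp_sigma_eq, ← map_mul, this, ← map_smul, ← map_add, ← map_sub]
  σ_D n i := by
    have : sA m κ n * dA m κ i = (dA m κ i - (2 * rootCoord m n i) •
        (rootCoord m n 0 • dA m κ 0 + rootCoord m n 1 • dA m κ 1 + rootCoord m n 2 • dA m κ 2)) *
          sA m κ n := by
      apply Subtype.ext
      have h := reflOp_mul_dunkl hm hκ (Nat.lt_succ_iff.mp n.2) i
      rw [Fin.sum_univ_three] at h
      exact h
    simp only [D_eq, grp_sigma_eq, ← map_mul, this, ← map_smul, ← map_add, ← map_sub]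

/-- The reflection in the third axis commutes with the reflections in the planar roots. -/
theorem grp_sigma_comm (a b : Fin (m + 1)) (ha : rootCoord m a 2 = 0)
    (hb0 : rootCoord m b 0 = 0) (hb1 : rootCoord m b 1 = 0) :
    grp m κ (sigma m b) * grp m κ (sigma m a) = grp m κ (sigma m a) * grp m κ (sigma m b) := by
  have hab : inner ℝ (root m a) (root m b) = 0 := by
    simp only [rootCoord, Complex.ofReal_eq_zero] at ha hb0 hb1
    rw [inner_eq_sum, Fin.sum_univ_three, ha, hb0, hb1]
    ring
  have : sA m κ b * sA m κ a = sA m κ a * sA m κ b := by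
    apply Subtype.ext
    have h := reflOp_mul_reflOp (inner_root_self m a) (inner_root_self m b)
    rw [refl_apply_of_unit (inner_root_self m b), hab, mul_zero, zero_smul, sub_zero] at h
    exact h
  simp only [grp_sigma_eq, ← map_mul, this]

theorem dirac_eq : dirac m κ = cliffordSum (e m κ) (D m κ) := by
  rw [dirac, Fin.sum_univ_three, cliffordSum]

theorem vecX_eq : vecX m κ = cliffordSum (e m κ) (x m κ) := by
  rw [vecX, Fin.sum_univ_three, cliffordSum]

theorem sigmaTilde_eq (n : Fin (m + 1)) :
    sigmaTilde m κ n = cliffordVec (e m κ) (rootCoord m n) * grp m κ (sigma m n) := by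
  rw [sigmaTilde, Fin.sum_univ_three, cliffordVec]
  rfl

variable (m κ) in
/-- The one-index symmetries as combinations of the elements `σ̃ⱼ`. -/
def oneSymC (i : Fin 3) : ClA m κ :=
  oneSym (e m κ) (rootCoord m) (fun n => κ (root m n)) (fun n => grp m κ (sigma m n)) i

variable (m κ) in
/-- The two-index symmetries, each labelled by the missing index. -/
def twoSymC (i : Fin 3) : ClA m κ :=
  twoSym (e m κ) (x m κ) (D m κ) (rootCoord m) (fun n => κ (root m n))
    (fun n => grp m κ (sigma m n)) i

theorem O1_eq (hm : m ≠ 0) (hκ : IsInvariant m κ) (i : Fin 3) : O1 m κ i = oneSymC m κ i := by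
  rw [O1, dirac_eq, (dunklRelations hm hκ).oneSym_eq, oneSymC]

theorem O123_eq (hm : m ≠ 0) (hκ : IsInvariant m κ) :
    O123 m κ = threeSym (e m κ) (x m κ) (D m κ) (fun n : Fin (m + 1) => κ (root m n))
      (fun n => grp m κ (sigma m n)) := by
  have h := dunklRelations hm hκ
  rw [O123, dirac_eq, vecX_eq, h.cliffordSum_commutator, threeSym, ← smul_mul_assoc,
    mul_add (e m κ 0 * e m κ 1 * e m κ 2), h.pseudoscalar_mul_spin, mul_smul_comm, mul_one]
  generalize e m κ 0 * e m κ 1 * e m κ 2 = J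
  simp only [add_mul, sub_mul, smul_mul_assoc, one_mul]
  module

theorem O2_eq (hm : m ≠ 0) (hκ : IsInvariant m κ) (i : Fin 3) :
    O2 m κ i (i + 1) = twoSymC m κ (i + 2) := by
  rw [O2, O1_eq hm hκ, O1_eq hm hκ]
  exact (dunklRelations hm hκ).twoSym_eq i

theorem oneSymC_eq_sum (i : Fin 3) :
    oneSymC m κ i = (κ (root m 0) * ((root m 0 i : ℝ) : ℂ)) • sigmaTilde m κ 0 +
      ∑ j : Fin m, (κ (root m ((j : ℕ) + 1)) * ((root m ((j : ℕ) + 1) i : ℝ) : ℂ)) •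
        sigmaTilde m κ j.succ := by
  simp only [oneSymC, oneSym, ← sigmaTilde_eq]
  rw [Fin.sum_univ_succ]
  rfl

theorem T0_eq : T0 m κ = Complex.I • oneSymC m κ 2 := by
  have h : ∀ j : ℕ, (root m (j + 1)) 2 = 0 := fun j => by simp [root]
  rw [T0, oneSymC_eq_sum]
  simp only [h, Complex.ofReal_zero, mul_zero, zero_smul, Finset.sum_const_zero, add_zero]
  simp [root, smul_smul]

theorem exp_root (m j : ℕ) : Complex.exp (((j : ℂ) + 1) * Real.pi * Complex.I / m) =
    -((root m (j + 1) 1 : ℝ) : ℂ) + ((root m (j + 1) 0 : ℝ) : ℂ) * Complex.I := by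
  have h : ((j : ℂ) + 1) * Real.pi * Complex.I / m =
      (((((j + 1 : ℕ) : ℝ) * Real.pi / m : ℝ)) : ℂ) * Complex.I := by
    push_cast
    ring
  rw [h, Complex.exp_mul_I]
  simp [root]

theorem exp_neg_root (m j : ℕ) : Complex.exp (-(((j : ℂ) + 1) * Real.pi * Complex.I / m)) =
    -((root m (j + 1) 1 : ℝ) : ℂ) - ((root m (j + 1) 0 : ℝ) : ℂ) * Complex.I := by
  have h : -(((j : ℂ) + 1) * Real.pi * Complex.I / m) =
      ((-(((j + 1 : ℕ) : ℝ) * Real.pi / m) : ℝ) : ℂ) * Complex.I := by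
    push_cast
    ring
  rw [h, Complex.exp_mul_I, ← Complex.ofReal_cos, ← Complex.ofReal_sin, Real.cos_neg, Real.sin_neg]
  simp [root, sub_eq_add_neg]

theorem Tplus_eq : Tplus m κ = oneSymC m κ 0 + Complex.I • oneSymC m κ 1 := by
  rw [Tplus, oneSymC_eq_sum, oneSymC_eq_sum]
  have h0 : ((root m 0 0 : ℝ) : ℂ) = 0 := by simp [root]
  have h1 : ((root m 0 1 : ℝ) : ℂ) = 0 := by simp [root]
  rw [h0, h1, mul_zero, zero_smul, zero_add, zero_add, Finset.smul_sum, Finset.smul_sum,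
    ← Finset.sum_add_distrib, ← Finset.sum_neg_distrib]
  refine Finset.sum_congr rfl fun j _ => ?_
  rw [exp_root, smul_smul, smul_smul, ← add_smul, ← neg_smul]
  congr 1
  linear_combination (-κ (root m (j + 1)) * ((root m (j + 1) 0 : ℝ) : ℂ)) * Complex.I_mul_I

theorem Tminus_eq : Tminus m κ = oneSymC m κ 0 - Complex.I • oneSymC m κ 1 := by
  rw [eq_sub_iff_add_eq, Tminus, oneSymC_eq_sum, oneSymC_eq_sum]
  have h0 : ((root m 0 0 : ℝ) : ℂ) = 0 := by simp [root]
  have h1 : ((root m 0 1 : ℝ) : ℂ) = 0 := by simp [root]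
  rw [h0, h1, mul_zero, zero_smul, zero_add, zero_add, Finset.smul_sum, Finset.smul_sum,
    ← Finset.sum_add_distrib]
  refine Finset.sum_congr rfl fun j _ => ?_
  rw [exp_neg_root, smul_smul, smul_smul, ← add_smul]
  congr 1
  linear_combination (-κ (root m (j + 1)) * ((root m (j + 1) 0 : ℝ) : ℂ)) * Complex.I_mul_I

theorem O0_eq (hm : m ≠ 0) (hκ : IsInvariant m κ) : O0 m κ = -(Complex.I • twoSymC m κ 2) := by
  have h : O2 m κ 0 1 = twoSymC m κ 2 := O2_eq hm hκ 0
  rw [O0, h]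

theorem Oplus_eq (hm : m ≠ 0) (hκ : IsInvariant m κ) :
    Oplus m κ = Complex.I • twoSymC m κ 1 + twoSymC m κ 0 := by
  have h : O2 m κ 1 2 = twoSymC m κ 0 := O2_eq hm hκ 1
  have h' : O2 m κ 2 0 = twoSymC m κ 1 := O2_eq hm hκ 2
  rw [Oplus, h, h']

theorem Ominus_eq (hm : m ≠ 0) (hκ : IsInvariant m κ) :
    Ominus m κ = Complex.I • twoSymC m κ 1 - twoSymC m κ 0 := by
  have h : O2 m κ 1 2 = twoSymC m κ 0 := O2_eq hm hκ 1
  have h' : O2 m κ 2 0 = twoSymC m κ 1 := O2_eq hm hκ 2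
  rw [Ominus, h, h']

/-- The ladder relations and the factorisations for elements with the defining properties of the
symmetries. Stated for variables, since with the symmetries themselves the kernel unfolds them
while identifying the operations of `Cl(3) ⊗ 𝒜` with those of the abstract theorem. -/
theorem ladder_of_eq (hm : m ≠ 0) (hκ : IsInvariant m κ) {H E F T U V W L M k : ClA m κ}
    (hH : H = -(Complex.I • twoSymC m κ 2))
    (hE : E = Complex.I • twoSymC m κ 1 + twoSymC m κ 0)
    (hF : F = Complex.I • twoSymC m κ 1 - twoSymC m κ 0)
    (hT : T = Complex.I • oneSymC m κ 2)
    (hU : U = oneSymC m κ 0 + Complex.I • oneSymC m κ 1)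
    (hV : V = oneSymC m κ 0 - Complex.I • oneSymC m κ 1)
    (hW : W = threeSym (e m κ) (x m κ) (D m κ) (fun n : Fin (m + 1) => κ (root m n))
      (fun n => grp m κ (sigma m n)))
    (hL : L = (1 / 2 : ℂ) • (H * E + E * H)) (hM : M = (1 / 2 : ℂ) • (H * F + F * H))
    (hk : k = algebraMap ℂ (ClA m κ) (1 / 2)) :
    H * L - L * H = L ∧ H * M - M * H = -M ∧
    L * M = -(((H - k) ^ 2 + (W + T) ^ 2) * ((H - k) ^ 2 - U * V)) ∧
    M * L = -(((H + k) ^ 2 + (W - T) ^ 2) * ((H + k) ^ 2 - V * U)) :=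
  (dunklRelations hm hκ).ladder (isSplit_rootCoord m) grp_sigma_comm hH hE hF hT hU hV hW hL hM hk

end Concrete

end DihedralDunkl

end

theorem mainTheorem4 (m : ℕ) (hm : 2 ≤ m) (κ : DihedralDunkl.E3 → ℂ)
    (hκ : DihedralDunkl.IsInvariant m κ) :
    (DihedralDunkl.O0 m κ * DihedralDunkl.Lplus m κ
        - DihedralDunkl.Lplus m κ * DihedralDunkl.O0 m κ = DihedralDunkl.Lplus m κ) ∧
    (DihedralDunkl.O0 m κ * DihedralDunkl.Lminus m κ
        - DihedralDunkl.Lminus m κ * DihedralDunkl.O0 m κ = -DihedralDunkl.Lminus m κ) ∧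
    (DihedralDunkl.Lplus m κ * DihedralDunkl.Lminus m κ =
      -(((DihedralDunkl.O0 m κ - DihedralDunkl.half m κ) ^ 2
            + (DihedralDunkl.O123 m κ + DihedralDunkl.T0 m κ) ^ 2)
          * ((DihedralDunkl.O0 m κ - DihedralDunkl.half m κ) ^ 2
            - DihedralDunkl.Tplus m κ * DihedralDunkl.Tminus m κ))) ∧
    (DihedralDunkl.Lminus m κ * DihedralDunkl.Lplus m κ =
      -(((DihedralDunkl.O0 m κ + DihedralDunkl.half m κ) ^ 2
            + (DihedralDunkl.O123 m κ - DihedralDunkl.T0 m κ) ^ 2)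
          * ((DihedralDunkl.O0 m κ + DihedralDunkl.half m κ) ^ 2
            - DihedralDunkl.Tminus m κ * DihedralDunkl.Tplus m κ))) := by
  have hm0 : m ≠ 0 := by omega
  exact DihedralDunkl.ladder_of_eq hm0 hκ (DihedralDunkl.O0_eq hm0 hκ)
    (DihedralDunkl.Oplus_eq hm0 hκ) (DihedralDunkl.Ominus_eq hm0 hκ) DihedralDunkl.T0_eq
    DihedralDunkl.Tplus_eq DihedralDunkl.Tminus_eq (DihedralDunkl.O123_eq hm0 hκ)
    rfl rfl rfl
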